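/- Let $K$ be a field of characteristic $0$ and let $X$ be a topological space with Lusternik–Schnirelmann category $\mathrm{cat}_{LS}(X)\le 1$; here $\mathrm{cat}_{LS}(X)$ is the least integer $n$ such that $X$ can be covered by $n+1$ open subsets whose inclusions into $X$ are null-homotopic. Then $X$ is formal over $K$: the singular cochain dg-algebra $C^*(X;K)$, with the cup product, is connected to its cohomology algebra $H^*(X;K)$, regarded as a dg-algebra with zero differential, by a finite zigzag of quasi-isomorphisms of (unital, $\mathbb{Z}$-graded, associative) dg-algebras over $K$. -/

import Mathlib

universe u v w

section

open DirectSum CategoryTheory Simplicial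

/-- A (unital, associative, cohomologically `ℤ`-graded) differential graded algebra over `K`. -/
structure DGAlgebra (K : Type v) [Field K] where
  /-- the underlying algebra, i.e. the direct sum of all degrees -/
  carrier : Type w
  [ring : Ring carrier]
  [algebra : Algebra K carrier]
  /-- the submodule of homogeneous elements of degree `n` -/
  deg : ℤ → Submodule K carrier
  [graded : GradedAlgebra deg]
  /-- the differential -/
  d : carrier →ₗ[K] carrier
  d_mem : ∀ {n : ℤ} {a : carrier}, a ∈ deg n → d a ∈ deg (n + 1)
  d_d : ∀ a : carrier, d (d a) = 0
  leibniz : ∀ {n : ℤ} {a : carrier}, a ∈ deg n → ∀ b : carrier,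
    d (a * b) = d a * b + n.negOnePow • (a * d b)

namespace DGAlgebra

variable {K : Type v} [Field K]

attribute [instance] DGAlgebra.ring DGAlgebra.algebra DGAlgebra.graded

/-- A morphism of dg-algebras: a degree-preserving algebra map commuting with the differentials. -/
structure Hom (A B : DGAlgebra.{v, w} K) where
  toAlgHom : A.carrier →ₐ[K] B.carrier
  map_deg : ∀ {n : ℤ} {a : A.carrier}, a ∈ A.deg n → toAlgHom a ∈ B.deg n
  map_d : ∀ a : A.carrier, toAlgHom (A.d a) = B.d (toAlgHom a)

/-- A quasi-isomorphism of dg-algebras: the induced map `ker d / im d → ker d / im d` is injective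
(a cocycle that becomes a coboundary is a coboundary) and surjective (every cocycle of the target
is the image of a cocycle up to a coboundary). -/
def Hom.IsQuasiIso {A B : DGAlgebra.{v, w} K} (f : Hom A B) : Prop :=
  (∀ z : A.carrier, A.d z = 0 → (∃ b, B.d b = f.toAlgHom z) → ∃ a, A.d a = z) ∧
  (∀ y : B.carrier, B.d y = 0 → ∃ z, A.d z = 0 ∧ ∃ b, B.d b = y - f.toAlgHom z)

variable (A : DGAlgebra.{v, w} K)

theorem d_one : A.d 1 = 0 := by
  have h := A.leibniz (SetLike.GradedOne.one_mem : (1 : A.carrier) ∈ A.deg 0) 1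
  simpa using h

theorem d_mul_of_d_eq_zero (a : A.carrier) {b : A.carrier} (hb : A.d b = 0) :
    A.d (a * b) = A.d a * b := by
  induction a using DirectSum.Decomposition.inductionOn A.deg with
  | zero => simp
  | homogeneous m => simp [A.leibniz m.2, hb]
  | add m m' h h' => simp [add_mul, h, h']

/-- The differential commutes with taking homogeneous components. -/
theorem decompose_d (a : A.carrier) (n : ℤ) :
    (decompose A.deg (A.d a) (n + 1) : A.carrier) = A.d (decompose A.deg a n) := by
  induction a using DirectSum.Decomposition.inductionOn A.deg with
  | zero => simp
  | @homogeneous i m =>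
    by_cases h : i = n
    · subst h
      rw [decompose_of_mem_same _ (A.d_mem m.2), decompose_of_mem_same _ m.2]
    · rw [decompose_of_mem_ne _ (A.d_mem m.2) (by simpa using h), decompose_of_mem_ne _ m.2 h,
        map_zero]
  | add m m' h h' => simp [h, h']

theorem d_component_eq_zero {z : A.carrier} (hz : A.d z = 0) (n : ℤ) :
    A.d (decompose A.deg z n) = 0 := by
  rw [← decompose_d, hz]; simp

theorem mul_d_mem_range {z : A.carrier} (hz : A.d z = 0) (a : A.carrier) :
    ∃ b, A.d b = z * A.d a := by
  classical
  suffices h : z * A.d a ∈ LinearMap.range A.d from h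
  rw [← sum_support_decompose A.deg z, Finset.sum_mul]
  refine Submodule.sum_mem _ fun n _ => ⟨n.negOnePow • (decompose A.deg z n * a : A.carrier), ?_⟩
  rw [Units.smul_def, map_zsmul, A.leibniz (decompose A.deg z n).2, A.d_component_eq_zero hz n,
    zero_mul, zero_add, ← Units.smul_def, smul_smul, ← Int.negOnePow_add,
    Int.negOnePow_even _ ⟨n, rfl⟩, one_smul]

/-- The subalgebra of cocycles. -/
def cocycles : Subalgebra K A.carrier where
  carrier := {z | A.d z = 0}
  mul_mem' {a b} ha hb := by
    simp only [Set.mem_ofPred_eq] at *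
    rw [A.d_mul_of_d_eq_zero a hb, ha, zero_mul]
  add_mem' {a b} ha hb := by
    simp only [Set.mem_ofPred_eq] at *
    rw [map_add, ha, hb, add_zero]
  algebraMap_mem' r := by
    simp only [Set.mem_ofPred_eq]
    rw [Algebra.algebraMap_eq_smul_one, map_smul, d_one, smul_zero]

/-- The two-sided ideal of coboundaries in the algebra of cocycles. -/
def coboundaries : Ideal A.cocycles where
  carrier := {z | ∃ a, A.d a = z}
  add_mem' := by
    rintro _ _ ⟨a, ha⟩ ⟨b, hb⟩
    exact ⟨a + b, by simp [ha, hb]⟩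
  zero_mem' := ⟨0, by simp⟩
  smul_mem' := by
    rintro z x ⟨a, ha⟩
    obtain ⟨b, hb⟩ := A.mul_d_mem_range z.2 a
    exact ⟨b, by simp [hb, ha]⟩

instance : A.coboundaries.IsTwoSided where
  mul_mem_of_left {x} z := by
    rintro ⟨a, ha⟩
    exact ⟨a * z, by rw [A.d_mul_of_d_eq_zero a z.2, ha]; simp⟩

/-- The underlying algebra `ker d / im d` of the cohomology algebra. -/
def CohomologyRing : Type w := A.cocycles ⧸ A.coboundaries

instance : Ring A.CohomologyRing :=
  inferInstanceAs (Ring (A.cocycles ⧸ A.coboundaries))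

instance : Algebra K A.CohomologyRing :=
  inferInstanceAs (Algebra K (A.cocycles ⧸ A.coboundaries))

/-- The cohomology class of a cocycle, as a linear map. -/
def toCohomology : A.cocycles →ₗ[K] A.CohomologyRing :=
  (Ideal.Quotient.mkₐ K A.coboundaries).toLinearMap

theorem toCohomology_surjective : Function.Surjective A.toCohomology :=
  Ideal.Quotient.mk_surjective

theorem toCohomology_eq_zero {z : A.cocycles} :
    A.toCohomology z = 0 ↔ ∃ a, A.d a = z :=
  Ideal.Quotient.eq_zero_iff_mem

/-- The degree `n` part of cohomology: the classes of the cocycles of degree `n`. -/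
def cohomologyDeg (n : ℤ) : Submodule K A.CohomologyRing :=
  ((A.deg n).comap A.cocycles.val.toLinearMap).map A.toCohomology

/-- The degree `n` component of a cocycle. -/
def cocycleComponent (n : ℤ) : A.cocycles →ₗ[K] A.cocycles where
  toFun z := ⟨decompose A.deg (z : A.carrier) n, A.d_component_eq_zero z.2 n⟩
  map_add' x y := by ext; simp
  map_smul' r x := by
    ext
    simp only [SetLike.val_smul, decompose_smul, RingHom.id_apply]
    rfl

/-- The degree `n` component of a cohomology class. -/
def cohomologyComponent (n : ℤ) : A.CohomologyRing →ₗ[K] A.CohomologyRing where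
  toFun := Quotient.lift (fun z => A.toCohomology (A.cocycleComponent n z)) (by
    intro x y hxy
    have hxy' : A.toCohomology (x - y) = 0 := by
      rw [map_sub, sub_eq_zero]
      exact Quotient.sound hxy
    rw [← sub_eq_zero, ← map_sub, ← map_sub, toCohomology_eq_zero]
    obtain ⟨a, ha⟩ := A.toCohomology_eq_zero.1 hxy'
    refine ⟨decompose A.deg a (n - 1), ?_⟩
    rw [← decompose_d, sub_add_cancel, ha]; rfl)
  map_add' x y := by
    obtain ⟨x, rfl⟩ := A.toCohomology_surjective x
    obtain ⟨y, rfl⟩ := A.toCohomology_surjective y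
    rw [← map_add]
    change A.toCohomology _ = A.toCohomology _ + A.toCohomology _
    simp
  map_smul' r x := by
    obtain ⟨x, rfl⟩ := A.toCohomology_surjective x
    rw [← map_smul]
    change A.toCohomology _ = r • A.toCohomology _
    simp

theorem cohomologyComponent_toCohomology (n : ℤ) (z : A.cocycles) :
    A.cohomologyComponent n (A.toCohomology z) = A.toCohomology (A.cocycleComponent n z) := rfl

theorem cohomologyComponent_mem (n : ℤ) (x : A.CohomologyRing) :
    A.cohomologyComponent n x ∈ A.cohomologyDeg n := by
  obtain ⟨x, rfl⟩ := A.toCohomology_surjective x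
  exact ⟨A.cocycleComponent n x, (decompose A.deg (x : A.carrier) n).2, rfl⟩

theorem cohomologyComponent_same {n : ℤ} {x : A.CohomologyRing} (hx : x ∈ A.cohomologyDeg n) :
    A.cohomologyComponent n x = x := by
  obtain ⟨z, hz, rfl⟩ := hx
  rw [cohomologyComponent_toCohomology]
  congr 1
  exact Subtype.ext (decompose_of_mem_same A.deg hz)

theorem cohomologyComponent_ne {n m : ℤ} (hnm : n ≠ m) {x : A.CohomologyRing}
    (hx : x ∈ A.cohomologyDeg n) : A.cohomologyComponent m x = 0 := by
  obtain ⟨z, hz, rfl⟩ := hx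
  rw [cohomologyComponent_toCohomology]
  have : A.cocycleComponent m z = 0 := Subtype.ext (decompose_of_mem_ne A.deg hz hnm)
  rw [this, map_zero]

theorem cohomologyDeg_isInternal : DirectSum.IsInternal A.cohomologyDeg := by
  classical
  constructor
  · rw [injective_iff_map_eq_zero]
    intro x hx
    ext n
    have key : ∀ y : ⨁ i, A.cohomologyDeg i,
        A.cohomologyComponent n (DirectSum.coeAddMonoidHom A.cohomologyDeg y) = y n := by
      intro y
      induction y using DirectSum.induction_on with
      | zero => simp
      | of i y =>
        rw [DirectSum.coeAddMonoidHom_of]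
        by_cases h : i = n
        · subst h
          rw [A.cohomologyComponent_same y.2, DirectSum.of_eq_same]
        · rw [A.cohomologyComponent_ne h y.2, DirectSum.of_eq_of_ne _ _ _ (Ne.symm h)]; rfl
      | add y y' h h' => simp [h, h']
    rw [← key, hx]; simp
  · intro x
    obtain ⟨z, rfl⟩ := A.toCohomology_surjective x
    refine ⟨∑ n ∈ (decompose A.deg (z : A.carrier)).support,
      DirectSum.of (fun i => A.cohomologyDeg i) n ⟨A.toCohomology (A.cocycleComponent n z),
        A.cohomologyComponent_mem n (A.toCohomology z)⟩, ?_⟩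
    rw [map_sum]
    simp only [DirectSum.coeAddMonoidHom_of]
    rw [← map_sum]
    congr 1
    apply Subtype.ext
    rw [AddSubmonoidClass.coe_finsetSum]
    exact sum_support_decompose A.deg (z : A.carrier)

noncomputable instance : GradedAlgebra A.cohomologyDeg where
  one_mem := ⟨1, SetLike.GradedOne.one_mem (A := A.deg), rfl⟩
  mul_mem := by
    rintro i j _ _ ⟨x, hx, rfl⟩ ⟨y, hy, rfl⟩
    exact ⟨x * y, SetLike.GradedMul.mul_mem (A := A.deg) hx hy, rfl⟩
  toDecomposition := A.cohomologyDeg_isInternal.chooseDecomposition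

/-- The cohomology algebra `H(A)`, as a dg-algebra with zero differential. -/
noncomputable def cohomology : DGAlgebra.{v, w} K where
  carrier := A.CohomologyRing
  deg := A.cohomologyDeg
  d := 0
  d_mem _ := by simp
  d_d _ := by simp
  leibniz _ _ := by simp

/-- `A` is formal if it is linked to its cohomology algebra by a finite zigzag of
quasi-isomorphisms of dg-algebras. -/
def IsFormal : Prop :=
  Relation.EqvGen (fun B C : DGAlgebra.{v, w} K => ∃ f : Hom B C, f.IsQuasiIso) A A.cohomology

end DGAlgebra

/-- The `n`-cochains of a simplicial set `S` with values in `K`: all functions from the set of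
`n`-simplices to `K`, i.e. the linear dual of the free `K`-module on the `n`-simplices. -/
abbrev SSetCochain (S : SSet.{u}) (K : Type v) (n : ℕ) : Type (max u v) := S _⦋n⦌ → K

namespace SSetCochain


variable {S : SSet.{u}} {K : Type v} [Field K]

/-- The inclusion of the first `p + 1` vertices `0, …, p` of the `n`-simplex. -/
def front (p n : ℕ) (h : p ≤ n) : ⦋p⦌ ⟶ ⦋n⦌ :=
  SimplexCategory.mkHom ⟨fun i => ⟨i, by omega⟩, fun _ _ hij => hij⟩

/-- The inclusion of the last `q + 1` vertices `n - q, …, n` of the `n`-simplex. -/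
def back (q n : ℕ) (h : q ≤ n) : ⦋q⦌ ⟶ ⦋n⦌ :=
  SimplexCategory.mkHom ⟨fun i => ⟨n - q + i, by omega⟩, fun _ _ hij => by
    simpa using hij⟩

/-- The cup product `(f ∪ g)(σ) = f(σ|[0, …, p]) g(σ|[p, …, p + q])`. -/
def cup {p q : ℕ} (f : SSetCochain S K p) (g : SSetCochain S K q) : SSetCochain S K (p + q) :=
  fun σ => f (S.map (front p (p + q) (by omega)).op σ) * g (S.map (back q (p + q) (by omega)).op σ)

/-- The coboundary `(δ f)(σ) = ∑ᵢ (-1)ⁱ f(∂ᵢ σ)`. -/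
def coboundary (n : ℕ) : SSetCochain S K n →ₗ[K] SSetCochain S K (n + 1) where
  toFun f := fun σ => ∑ i : Fin (n + 2), (-1) ^ (i : ℕ) * f (S.δ i σ)
  map_add' f g := by
    funext σ
    change ∑ i : Fin (n + 2), (-1) ^ (i : ℕ) * (f (S.δ i σ) + g (S.δ i σ)) = _ + _
    simp only [mul_add, Finset.sum_add_distrib]
  map_smul' r f := by
    funext σ
    change ∑ i : Fin (n + 2), (-1) ^ (i : ℕ) * (r * f (S.δ i σ)) = r * _
    rw [Finset.mul_sum]
    exact Finset.sum_congr rfl fun i _ => by ring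

theorem hom_ext {a b : ℕ} {x y : ⦋a⦌ ⟶ ⦋b⦌}
    (h : ∀ i : Fin (a + 1), (x.toOrderHom i : ℕ) = y.toOrderHom i) : x = y := by
  ext i
  exact h i

theorem map_map {a b c : ℕ} (x : ⦋a⦌ ⟶ ⦋b⦌) (y : ⦋b⦌ ⟶ ⦋c⦌) (σ : S _⦋c⦌) :
    S.map x.op (S.map y.op σ) = S.map (x ≫ y).op σ := by
  simp

theorem comp_apply' {a b c : ℕ} (x : ⦋a⦌ ⟶ ⦋b⦌) (y : ⦋b⦌ ⟶ ⦋c⦌) (i : Fin (a + 1)) :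
    (x ≫ y).toOrderHom i = y.toOrderHom (x.toOrderHom i) := rfl

/-- Two cochains whose degrees are propositionally equal agree if they agree on simplices. -/
theorem mk_eq_mk {n m : ℕ} {f : SSetCochain S K n} {g : SSetCochain S K m} (h : m = n)
    (H : ∀ σ : S _⦋n⦌, f σ = g (S.map (front m n h.le).op σ)) :
    (GradedMonoid.mk n f : GradedMonoid (SSetCochain S K)) = GradedMonoid.mk m g := by
  subst h
  congr 1
  funext σ
  rw [H]
  have : front m m le_rfl = 𝟙 _ := hom_ext fun i => rfl
  rw [this]
  simp

theorem front_apply (p n : ℕ) (h : p ≤ n) (i : Fin (p + 1)) :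
    ((front p n h).toOrderHom i : ℕ) = i := rfl

theorem back_apply (q n : ℕ) (h : q ≤ n) (i : Fin (q + 1)) :
    ((back q n h).toOrderHom i : ℕ) = n - q + i := rfl

theorem δ_cases {n : ℕ} (i : Fin (n + 2)) (j : Fin (n + 1)) :
    ((j : ℕ) < i ∧ ((SimplexCategory.δ i).toOrderHom j : ℕ) = j) ∨
      ((i : ℕ) ≤ j ∧ ((SimplexCategory.δ i).toOrderHom j : ℕ) = j + 1) := by
  change ((j : ℕ) < i ∧ ((i.succAbove j : Fin (n + 2)) : ℕ) = j) ∨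
    ((i : ℕ) ≤ j ∧ ((i.succAbove j : Fin (n + 2)) : ℕ) = j + 1)
  simp only [Fin.succAbove, Fin.lt_def, Fin.val_castSucc]
  split_ifs <;> simp <;> omega

/-- Multiplication of homogeneous cochains is the cup product. -/
instance : GradedMonoid.GMul (SSetCochain S K) where
  mul f g := cup f g

/-- The unit is the `0`-cochain with constant value `1`. -/
instance : GradedMonoid.GOne (SSetCochain S K) where
  one := fun _ => 1

theorem cup_assoc_apply {p q r : ℕ} (f : SSetCochain S K p) (g : SSetCochain S K q)
    (h : SSetCochain S K r) (σ : S _⦋p + q + r⦌) :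
    cup (cup f g) h σ =
      cup f (cup g h) (S.map (front (p + (q + r)) (p + q + r) (by omega)).op σ) := by
  simp only [cup, map_map, mul_assoc]
  have e1 : back q (p + q) (by omega) ≫ front (p + q) (p + q + r) (by omega) =
      front q (q + r) (by omega) ≫ back (q + r) (p + (q + r)) (by omega) ≫
        front (p + (q + r)) (p + q + r) (by omega) := by
    apply hom_ext
    intro i
    simp only [comp_apply', front_apply, back_apply]
    omega
  have e2 : back r (p + q + r) (by omega) = back r (q + r) (by omega) ≫
      back (q + r) (p + (q + r)) (by omega) ≫ front (p + (q + r)) (p + q + r) (by omega) := by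
    apply hom_ext
    intro i
    simp only [comp_apply', front_apply, back_apply]
    omega
  rw [e1, e2]
  rfl

theorem back_eq_front (n m : ℕ) (h : n = m) : back n m h.le = front n m h.le := by
  apply hom_ext
  intro i
  simp only [front_apply, back_apply]
  omega

instance : DirectSum.GRing (SSetCochain S K) where
  mul_zero f := by funext σ; exact mul_zero _
  zero_mul f := by funext σ; exact zero_mul _
  mul_add f g h := by funext σ; exact mul_add _ _ _
  add_mul f g h := by funext σ; exact add_mul _ _ _
  one_mul := by
    rintro ⟨n, f⟩
    refine mk_eq_mk (show n = 0 + n by simp) fun σ => ?_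
    change (1 : K) * f (S.map (back n (0 + n) _).op σ) = f _
    rw [one_mul, back_eq_front n (0 + n) (by omega)]
    rfl
  mul_one := by
    rintro ⟨n, f⟩
    refine mk_eq_mk (show n = n + 0 by simp) fun σ => ?_
    change f _ * (1 : K) = f _
    rw [mul_one]
  mul_assoc := by
    rintro ⟨p, f⟩ ⟨q, g⟩ ⟨r, h⟩
    exact mk_eq_mk (show p + (q + r) = p + q + r by omega) fun σ => cup_assoc_apply f g h σ
  natCast n := fun _ => n
  natCast_zero := by funext σ; exact Nat.cast_zero
  natCast_succ n := by funext σ; exact Nat.cast_succ n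
  intCast n := fun _ => n
  intCast_ofNat n := by funext σ; exact Int.cast_natCast n
  intCast_negSucc_ofNat n := by funext σ; exact Int.cast_negSucc n

instance : DirectSum.GAlgebra K (SSetCochain S K) where
  toFun := { toFun := fun r _ => r, map_zero' := rfl, map_add' := fun _ _ => rfl }
  map_one := rfl
  map_mul r s := mk_eq_mk (show 0 + 0 = 0 from rfl) fun σ => rfl
  commutes := by
    rintro r ⟨n, f⟩
    refine mk_eq_mk (show n + 0 = 0 + n by simp) fun σ => ?_
    change r * f (S.map (back n (0 + n) _).op σ) =
      f (S.map (front n (n + 0) _).op (S.map (front (n + 0) (0 + n) _).op σ)) * r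
    rw [mul_comm, back_eq_front n (0 + n) (by omega)]
    exact congrArg (fun x => f x * r) (map_map (front n (n + 0) _) (front (n + 0) (0 + n) _) σ).symm
  smul_def := by
    rintro r ⟨n, f⟩
    refine mk_eq_mk (show 0 + n = n by simp) fun σ => ?_
    change r * f σ = r * f (S.map (back n (0 + n) _).op (S.map (front (0 + n) n _).op σ))
    have e : back n (0 + n) (by omega) ≫ front (0 + n) n (by omega) = 𝟙 _ := by
      apply hom_ext
      intro i
      simp only [comp_apply', front_apply, back_apply]
      change _ = (i : ℕ)
      omega
    have := map_map (back n (0 + n) (by omega)) (front (0 + n) n (by omega)) σ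
    rw [e] at this
    exact congrArg (fun x => r * f x) (by simpa using this.symm)

theorem coboundary_apply {n : ℕ} (f : SSetCochain S K n) (σ : S _⦋n + 1⦌) :
    coboundary n f σ = ∑ i : Fin (n + 2), (-1) ^ (i : ℕ) * f (S.map (SimplexCategory.δ i).op σ) :=
  rfl

theorem coboundary_coboundary (n : ℕ) (f : SSetCochain S K n) :
    coboundary (n + 1) (coboundary n f) = 0 := by
  funext σ
  change _ = (0 : K)
  simp only [coboundary_apply, Finset.mul_sum, map_map, ← Finset.sum_product']
  rw [Finset.univ_product_univ]
  let T : Finset (Fin (n + 3) × Fin (n + 2)) := {ij | (ij.1 : ℕ) ≤ (ij.2 : ℕ)}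
  rw [← Finset.sum_add_sum_compl T, ← eq_neg_iff_add_eq_zero, ← Finset.sum_neg_distrib]
  refine Finset.sum_bij'
    (fun ij hij => (ij.2.succ, Fin.castLT ij.1
      (lt_of_le_of_lt (Finset.mem_filter.mp hij).right (Fin.is_lt ij.2))))
    (fun ij hij => (ij.2.castSucc, ij.1.pred (by
      rintro h
      simp [T, h] at hij))) ?_ ?_ ?_ ?_ ?_
  · rintro ⟨i, j⟩ hij
    simp only [T, Finset.compl_filter, Finset.mem_filter_univ, Fin.val_succ,
      Fin.val_castLT] at hij ⊢
    omega
  · rintro ⟨i, j⟩ hij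
    simp only [T, Finset.compl_filter, Finset.mem_filter_univ, Fin.val_castSucc,
      Fin.val_pred] at hij ⊢
    omega
  · rintro ⟨i, j⟩ hij
    simp
  · rintro ⟨i, j⟩ hij
    simp
  · rintro ⟨i, j⟩ hij
    simp only [T, Finset.mem_filter_univ] at hij
    have : SimplexCategory.δ j ≫ SimplexCategory.δ i =
        SimplexCategory.δ (Fin.castLT i (by omega)) ≫ SimplexCategory.δ j.succ := by
      apply hom_ext
      intro k
      have h1 := δ_cases j k
      have h2 := δ_cases i ((SimplexCategory.δ j).toOrderHom k)
      have h3 := δ_cases (Fin.castLT i (by omega)) k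
      have h4 := δ_cases j.succ ((SimplexCategory.δ (Fin.castLT i (by omega))).toOrderHom k)
      simp only [comp_apply', Fin.val_succ, Fin.val_castLT] at *
      omega
    simp only [this, Fin.val_succ, Fin.val_castLT]
    ring

/-- The coboundary on the direct sum of all cochain groups. -/
noncomputable def totalCoboundary (S : SSet.{u}) (K : Type v) [Field K] :
    (⨁ n, SSetCochain S K n) →ₗ[K] (⨁ n, SSetCochain S K n) :=
  DirectSum.toModule K ℕ _ fun n => DirectSum.lof K ℕ (SSetCochain S K) (n + 1) ∘ₗ coboundary n

theorem totalCoboundary_of (n : ℕ) (f : SSetCochain S K n) :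
    totalCoboundary S K (DirectSum.of _ n f) = DirectSum.of _ (n + 1) (coboundary n f) :=
  DirectSum.toModule_lof K n f

/-- The cochains of degree `k`; there are none in negative degrees. -/
def degree (S : SSet.{u}) (K : Type v) [Field K] : ℤ → Submodule K (⨁ n, SSetCochain S K n) :=
  fun k => match k with
    | Int.ofNat n => LinearMap.range (DirectSum.lof K ℕ (SSetCochain S K) n)
    | Int.negSucc _ => ⊥

theorem of_mem_degree (n : ℕ) (f : SSetCochain S K n) :
    DirectSum.of _ n f ∈ degree S K (n : ℤ) := ⟨f, rfl⟩

theorem eq_of_mem_degree {k : ℤ} {x : ⨁ n, SSetCochain S K n} (hx : x ∈ degree S K k) :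
    x = 0 ∨ ∃ (n : ℕ) (f : SSetCochain S K n), k = n ∧ x = DirectSum.of _ n f := by
  cases k with
  | ofNat n =>
    obtain ⟨f, rfl⟩ := hx
    exact Or.inr ⟨n, f, rfl, rfl⟩
  | negSucc n => exact Or.inl hx

instance : SetLike.GradedMonoid (degree S K) where
  one_mem := of_mem_degree 0 _
  mul_mem := by
    intro i j x y hx hy
    obtain rfl | ⟨p, f, rfl, rfl⟩ := eq_of_mem_degree hx
    · rw [zero_mul]; exact zero_mem _
    obtain rfl | ⟨q, g, rfl, rfl⟩ := eq_of_mem_degree hy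
    · rw [mul_zero]; exact zero_mem _
    rw [DirectSum.of_mul_of]
    exact_mod_cast of_mem_degree (p + q) _

noncomputable instance : DirectSum.Decomposition (degree S K) :=
  DirectSum.Decomposition.ofLinearMap (degree S K)
    (DirectSum.toModule K ℕ _ fun n =>
      DirectSum.lof K ℤ (fun k => degree S K k) (n : ℤ) ∘ₗ
        (DirectSum.lof K ℕ (SSetCochain S K) n).rangeRestrict)
    (by
      ext n f : 2
      rw [LinearMap.comp_apply, LinearMap.comp_apply, DirectSum.toModule_lof]
      exact DirectSum.coeLinearMap_lof (degree S K) (n : ℤ) _)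
    (by
      ext k x : 2
      obtain ⟨x, hx⟩ := x
      simp only [LinearMap.comp_apply, DirectSum.coeLinearMap_lof, LinearMap.id_apply]
      cases k with
      | ofNat n =>
        obtain ⟨f, rfl⟩ := hx
        simp only [DirectSum.toModule_lof]
        rfl
      | negSucc n =>
        have h0 : x = 0 := hx
        have : (⟨x, hx⟩ : degree S K (Int.negSucc n)) = 0 := Subtype.ext h0
        rw [this, h0, map_zero, map_zero])

noncomputable instance : GradedAlgebra (degree S K) where

theorem coboundary_cup_apply {p q : ℕ} (f : SSetCochain S K p) (g : SSetCochain S K q)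
    (σ : S _⦋p + q + 1⦌) :
    coboundary (p + q) (cup f g) σ =
      cup (coboundary p f) g (S.map (front (p + 1 + q) (p + q + 1) (by omega)).op σ) +
      (-1) ^ p * cup f (coboundary q g) σ := by
  have hF : ∀ i : Fin (p + q + 2), (p : ℕ) < i → front p (p + q) (by omega) ≫
      SimplexCategory.δ i = front p (p + q + 1) (by omega) := by
    intro i hi
    apply hom_ext
    intro k
    have h1 := δ_cases i ((front p (p + q) (by omega)).toOrderHom k)
    simp only [comp_apply', front_apply] at *
    omega
  have hB : ∀ i : Fin (p + q + 2), (i : ℕ) ≤ p → back q (p + q) (by omega) ≫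
      SimplexCategory.δ i = back q (p + q + 1) (by omega) := by
    intro i hi
    apply hom_ext
    intro k
    have h1 := δ_cases i ((back q (p + q) (by omega)).toOrderHom k)
    simp only [comp_apply', back_apply] at *
    omega
  have hF' : ∀ (i : Fin (p + q + 2)) (j : Fin (p + 2)), (i : ℕ) = j →
      front p (p + q) (by omega) ≫ SimplexCategory.δ i =
      SimplexCategory.δ j ≫ front (p + 1) (p + q + 1) (by omega) := by
    intro i j hij
    apply hom_ext
    intro k
    have h1 := δ_cases i ((front p (p + q) (by omega)).toOrderHom k)
    have h2 := δ_cases j k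
    simp only [comp_apply', front_apply] at *
    omega
  have hB' : ∀ (i : Fin (p + q + 2)) (j : Fin (q + 2)), (i : ℕ) = p + j →
      back q (p + q) (by omega) ≫ SimplexCategory.δ i =
      SimplexCategory.δ j ≫ back (q + 1) (p + q + 1) (by omega) := by
    intro i j hij
    apply hom_ext
    intro k
    have h1 := δ_cases i ((back q (p + q) (by omega)).toOrderHom k)
    have h2 := δ_cases j k
    simp only [comp_apply', back_apply] at *
    omega
  have e1 : front (p + 1) (p + 1 + q) (by omega) ≫ front (p + 1 + q) (p + q + 1) (by omega) =
      front (p + 1) (p + q + 1) (by omega) := hom_ext fun k => rfl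
  have e2 : back q (p + 1 + q) (by omega) ≫ front (p + 1 + q) (p + q + 1) (by omega) =
      back q (p + q + 1) (by omega) := by
    apply hom_ext
    intro k
    simp only [comp_apply', front_apply, back_apply]
    omega
  have e3 : SimplexCategory.δ (Fin.last (p + 1)) ≫ front (p + 1) (p + q + 1) (by omega) =
      front p (p + q + 1) (by omega) := by
    apply hom_ext
    intro k
    have h1 := δ_cases (Fin.last (p + 1)) k
    simp only [comp_apply', front_apply, Fin.val_last] at *
    omega
  have e4 : SimplexCategory.δ 0 ≫ back (q + 1) (p + q + 1) (by omega) =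
      back q (p + q + 1) (by omega) := by
    apply hom_ext
    intro k
    have h1 := δ_cases 0 k
    simp only [comp_apply', back_apply, Fin.val_zero] at *
    omega
  simp only [cup, coboundary_apply, map_map, e1, e2]
  change _ = _ + (-1) ^ p * (f (S.map (front p (p + q + 1) _).op σ) * ∑ x, _ *
    g (S.map (_ ≫ back (q + 1) (p + q + 1) _).op σ))
  have hsum : ∀ F : Fin (p + q + 2) → K, ∑ i, F i =
      ∑ i : Fin (p + 1), F (Fin.cast (by omega) (Fin.castAdd (q + 1) i)) +
      ∑ i : Fin (q + 1), F (Fin.cast (by omega) (Fin.natAdd (p + 1) i)) := by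
    intro F
    rw [← Fin.sum_univ_add (fun i : Fin ((p + 1) + (q + 1)) => F (Fin.cast (by omega) i))]
    exact Fintype.sum_equiv (finCongr (by omega)) _ _ fun i => rfl
  rw [Fin.sum_univ_castSucc (n := p + 1), Fin.sum_univ_succ (n := q + 1), e3, e4, hsum]
  have s1 := fun i : Fin (p + 1) =>
    hF' (Fin.cast (by omega) (Fin.castAdd (q + 1) i)) i.castSucc rfl
  have s2 := fun i : Fin (p + 1) =>
    hB (Fin.cast (by omega) (Fin.castAdd (q + 1) i)) (by simpa using Nat.lt_succ_iff.1 i.2)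
  have s3 := fun i : Fin (q + 1) =>
    hF (Fin.cast (by omega) (Fin.natAdd (p + 1) i)) (by simp; omega)
  have s4 := fun i : Fin (q + 1) =>
    hB' (Fin.cast (by omega) (Fin.natAdd (p + 1) i)) i.succ (by simp; omega)
  simp only [s1, s2, s3, s4, Fin.val_cast, Fin.val_castAdd, Fin.val_natAdd, Fin.val_castSucc,
    Fin.val_succ, Fin.val_last, Fin.val_zero]
  rw [add_mul, mul_add, mul_add, Finset.sum_mul, Finset.mul_sum, Finset.mul_sum]
  have t1 : ∀ a b c : K, a * (b * c) = a * b * c := fun a b c => (mul_assoc a b c).symm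
  have t2 : ∀ (i : ℕ) (b c : K), (-1) ^ (p + 1 + i) * (b * c) =
      (-1) ^ p * (b * ((-1) ^ (i + 1) * c)) := fun i b c => by ring
  simp only [t2]
  simp only [t1]
  ring

theorem coboundary_cup {p q : ℕ} (f : SSetCochain S K p) (g : SSetCochain S K q) :
    (DirectSum.of (SSetCochain S K) (p + q + 1) (coboundary (p + q) (cup f g))) =
      DirectSum.of (SSetCochain S K) (p + 1 + q) (cup (coboundary p f) g) +
      (p : ℤ).negOnePow •
        DirectSum.of (SSetCochain S K) (p + (q + 1)) (cup f (coboundary q g)) := by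
  have h1 : DirectSum.of (SSetCochain S K) (p + 1 + q) (cup (coboundary p f) g) =
      DirectSum.of (SSetCochain S K) (p + q + 1) (fun σ =>
        cup (coboundary p f) g (S.map (front (p + 1 + q) (p + q + 1) (by omega)).op σ)) :=
    DirectSum.of_eq_of_gradedMonoid_eq
      (mk_eq_mk (show p + 1 + q = p + q + 1 by omega) fun σ => rfl).symm
  have h2 : (p : ℤ).negOnePow •
        DirectSum.of (SSetCochain S K) (p + (q + 1)) (cup f (coboundary q g)) =
      DirectSum.of (SSetCochain S K) (p + q + 1)
        (fun σ => (-1 : K) ^ p * cup f (coboundary q g) σ) := by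
    rw [Units.smul_def, ← map_zsmul]
    congr 1
    funext σ
    change (((p : ℤ).negOnePow : ℤˣ) : ℤ) • cup f (coboundary q g) σ = _
    rw [zsmul_eq_mul]
    simp [Int.negOnePow]
  rw [h1, h2]
  refine Eq.trans ?_ (map_add (DirectSum.of (SSetCochain S K) (p + q + 1)) _ _)
  congr 1
  funext σ
  exact coboundary_cup_apply f g σ

/-- The dg-algebra of cochains on a simplicial set `S`, with the cup product and the coboundary. -/
noncomputable def cochainAlgebra (S : SSet.{u}) (K : Type v) [Field K] :
    DGAlgebra.{v, max u v} K where
  carrier := ⨁ n, SSetCochain S K n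
  deg := degree S K
  d := totalCoboundary S K
  d_mem {k x} hx := by
    obtain rfl | ⟨n, f, rfl, rfl⟩ := eq_of_mem_degree hx
    · rw [map_zero]; exact zero_mem _
    rw [totalCoboundary_of]
    exact_mod_cast of_mem_degree (n + 1) _
  d_d x := by
    induction x using DirectSum.induction_on with
    | zero => simp
    | of n f => rw [totalCoboundary_of, totalCoboundary_of, coboundary_coboundary, map_zero]
    | add x y hx hy => rw [map_add, map_add, hx, hy, add_zero]
  leibniz {k x} hx y := by
    obtain rfl | ⟨p, f, rfl, rfl⟩ := eq_of_mem_degree hx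
    · simp
    induction y using DirectSum.induction_on with
    | zero => simp
    | of q g =>
      rw [totalCoboundary_of, totalCoboundary_of, DirectSum.of_mul_of, DirectSum.of_mul_of,
        DirectSum.of_mul_of, totalCoboundary_of]
      exact coboundary_cup f g
    | add x y hx hy =>
      rw [mul_add, map_add, hx, hy, map_add, mul_add, mul_add, smul_add]
      abel

end SSetCochain

/-- The singular cochain dg-algebra `C*(X; K)` of a topological space `X`. -/
noncomputable def singularCochainAlgebra (X : Type u) [TopologicalSpace X] (K : Type v) [Field K] :
    DGAlgebra.{v, max u v} K :=
  SSetCochain.cochainAlgebra (TopCat.toSSet.obj (TopCat.of X)) K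

/-- `X` is covered by `m` open subsets whose inclusions into `X` are null-homotopic. -/
def HasCategoricalCover (X : Type u) [TopologicalSpace X] (m : ℕ) : Prop :=
  ∃ U : Fin m → Set X, (∀ i, IsOpen (U i)) ∧ (⋃ i, U i) = Set.univ ∧
    ∀ i, (⟨Subtype.val, continuous_subtype_val⟩ : C(U i, X)).Nullhomotopic

/-- The Lusternik-Schnirelmann category of `X`: the least `n` such that `X` is covered by `n + 1`
open subsets that are contractible in `X`, and `⊤` if there is none. (For nonempty `X` a cover by
fewer sets can be padded by repetition; allowing fewer sets only makes the empty space, which is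
covered by no sets at all, have category `0`.) -/
noncomputable def lsCat (X : Type u) [TopologicalSpace X] : ℕ∞ :=
  ⨅ (n : ℕ) (_ : ∃ m ≤ n + 1, HasCategoricalCover X m), (n : ℕ∞)

end

/-!
Let `X = U ∪ V` with `U` and `V` open. By subdivision, `C(X)` is quasi-isomorphic to the homotopy
pullback of `C(U) → C(U ∩ V) ← C(V)`: its elements are `((a, b), m)`, with differential
`((da, db), a|_{U ∩ V} - b|_{U ∩ V} - dm)`. If `U` and `V` are null-homotopic in `X`, a class of
positive degree restricts to zero on both, so it is represented by a link `((0, 0), m)`. Links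
multiply to zero. If `U ∩ V` is nonempty, the cocycles of degree `0` are the constants, so a linear
section of the projection from cocycles to cohomology can be chosen with values in `K ⊕ links`
and fixing `1`; it is multiplicative, hence a quasi-isomorphism from the cohomology algebra. If
`U` and `V` are disjoint, the cohomology is concentrated in degree `0`, where the only coboundary
is `0`, and every linear section by cocycles of degree `0` is multiplicative.
-/

open DirectSum CategoryTheory Simplicial

/-! ### Formality criteria -/

namespace DGAlgebra

variable {K : Type v} [Field K] {A B : DGAlgebra.{v, w} K}

section QuasiIso

theorem toCohomology_one : A.toCohomology 1 = 1 := rfl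

theorem toCohomology_mul (x y : A.cocycles) :
    A.toCohomology (x * y) = A.toCohomology x * A.toCohomology y := rfl

theorem toCohomology_eq_toCohomology_iff {x y : A.cocycles} :
    A.toCohomology x = A.toCohomology y ↔ ∃ a, A.d a = x - y := by
  rw [← sub_eq_zero, ← map_sub, toCohomology_eq_zero, Subalgebra.coe_sub]

/-- The algebra map on cocycles induced by a morphism of dg-algebras. -/
def Hom.cocyclesMap (f : Hom A B) : A.cocycles →ₐ[K] B.cocycles :=
  (f.toAlgHom.comp A.cocycles.val).codRestrict B.cocycles fun z => by
    have hz : A.d z = 0 := z.2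
    change B.d (f.toAlgHom z) = 0
    rw [← f.map_d, hz, map_zero]

/-- The morphism `H(f) : H(A) → H(B)` induced by a morphism of dg-algebras. -/
noncomputable def Hom.cohomologyMap (f : Hom A B) : Hom A.cohomology B.cohomology where
  toAlgHom := Ideal.quotientMapₐ B.coboundaries f.cocyclesMap fun z ⟨a, ha⟩ =>
    ⟨f.toAlgHom a, by rw [← f.map_d, ha]; rfl⟩
  map_deg := by
    rintro n _ ⟨z, hz, rfl⟩
    exact ⟨f.cocyclesMap z, f.map_deg hz, rfl⟩
  map_d _ := map_zero _

theorem Hom.cohomologyMap_toCohomology (f : Hom A B) (z : A.cocycles) :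
    f.cohomologyMap.toAlgHom (A.toCohomology z) = B.toCohomology (f.cocyclesMap z) := rfl

theorem Hom.IsQuasiIso.of_bijective {f : Hom A B} (hf : Function.Bijective f.toAlgHom) :
    f.IsQuasiIso := by
  constructor
  · rintro z - ⟨b, hb⟩
    obtain ⟨a, rfl⟩ := hf.2 b
    exact ⟨a, hf.1 (by rw [f.map_d, hb])⟩
  · intro y hy
    obtain ⟨z, rfl⟩ := hf.2 y
    exact ⟨z, hf.1 (by rw [f.map_d, hy, map_zero]), 0, by simp⟩

theorem Hom.IsQuasiIso.cohomologyMap_bijective {f : Hom A B} (hf : f.IsQuasiIso) :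
    Function.Bijective f.cohomologyMap.toAlgHom := by
  constructor
  · rw [injective_iff_map_eq_zero]
    intro x hx
    obtain ⟨z, rfl⟩ := A.toCohomology_surjective x
    rw [Hom.cohomologyMap_toCohomology] at hx
    exact A.toCohomology_eq_zero.2 (hf.1 z z.2 (B.toCohomology_eq_zero.1 hx))
  · intro y
    obtain ⟨y, rfl⟩ := B.toCohomology_surjective y
    obtain ⟨z, hz, hzy⟩ := hf.2 y y.2
    exact ⟨A.toCohomology ⟨z, hz⟩, (toCohomology_eq_toCohomology_iff.2 hzy).symm⟩

theorem IsFormal.of_isQuasiIso {f : Hom A B} (hf : f.IsQuasiIso) (hB : B.IsFormal) :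
    A.IsFormal :=
  .trans _ _ _ (.rel _ _ ⟨f, hf⟩) <| .trans _ _ _ hB <|
    .symm _ _ <| .rel _ _ ⟨f.cohomologyMap, .of_bijective hf.cohomologyMap_bijective⟩

end QuasiIso

section Formality

theorem isFormal_of_one_mem_coboundaries (h : ∃ a, A.d a = 1) : A.IsFormal := by
  have : Subsingleton A.cohomology.carrier := subsingleton_of_zero_eq_one
    (toCohomology_one (A := A) ▸ (A.toCohomology_eq_zero.2 h).symm)
  let f : Hom A A.cohomology :=
    { toAlgHom :=
        { toFun := fun _ => 0
          map_one' := Subsingleton.elim _ _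
          map_mul' := fun _ _ => Subsingleton.elim _ _
          map_zero' := rfl
          map_add' := fun _ _ => Subsingleton.elim _ _
          commutes' := fun _ => Subsingleton.elim _ _ }
      map_deg := fun _ => zero_mem _
      map_d := fun _ => Subsingleton.elim _ _ }
  refine .rel _ _ ⟨f, fun z hz _ => ?_, fun y _ => ⟨0, map_zero _, 0, Subsingleton.elim _ _⟩⟩
  obtain ⟨a, ha⟩ := h
  exact ⟨a * z, by rw [A.d_mul_of_d_eq_zero a hz, ha, one_mul]⟩

theorem isFormal_of_section (s : A.CohomologyRing →ₐ[K] A.cocycles)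
    (hs : ∀ x, A.toCohomology (s x) = x)
    (hdeg : ∀ n, ∀ x ∈ A.cohomologyDeg n, (s x : A.carrier) ∈ A.deg n) : A.IsFormal := by
  let f : Hom A.cohomology A :=
    { toAlgHom := A.cocycles.val.comp s
      map_deg := fun {n x} hx => hdeg n x hx
      map_d := fun x => (map_zero _).trans (s x).2.symm }
  refine .symm _ _ <| .rel _ _ ⟨f, fun x _ hx => ⟨0, ?_⟩, fun y hy =>
    ⟨A.toCohomology ⟨y, hy⟩, rfl, ?_⟩⟩
  · rw [map_zero, ← hs x]
    exact (A.toCohomology_eq_zero.2 hx).symm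
  · exact toCohomology_eq_toCohomology_iff.1 (hs (A.toCohomology ⟨y, hy⟩)).symm

theorem exists_linear_section (Q : ℤ → Submodule K A.cocycles)
    (hQ : ∀ n, ∀ x ∈ A.cohomologyDeg n, ∃ z ∈ Q n, A.toCohomology z = x) :
    ∃ s : A.CohomologyRing →ₗ[K] A.cocycles, (∀ x, A.toCohomology (s x) = x) ∧
      ∀ n, ∀ x ∈ A.cohomologyDeg n, s x ∈ Q n := by
  have lift_deg (n : ℤ) : ∃ s : A.cohomologyDeg n →ₗ[K] A.cocycles,
      ∀ x, s x ∈ Q n ∧ A.toCohomology (s x) = x := by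
    let p : ↥(Q n ⊓ (A.cohomologyDeg n).comap A.toCohomology) →ₗ[K] A.cohomologyDeg n :=
      A.toCohomology.restrict fun _ hz => hz.2
    have hp : Function.Surjective p := fun x => by
      obtain ⟨z, hz, hzx⟩ := hQ n x x.2
      exact ⟨⟨z, hz, by simp [hzx]⟩, Subtype.ext hzx⟩
    obtain ⟨s, hs⟩ := p.exists_rightInverse_of_surjective (LinearMap.range_eq_top.2 hp)
    exact ⟨Submodule.subtype _ ∘ₗ s, fun x =>
      ⟨(s x).2.1, congrArg Subtype.val (LinearMap.congr_fun hs x)⟩⟩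
  choose s hs using lift_deg
  have apply_of_mem (n : ℤ) (x : A.CohomologyRing) (hx : x ∈ A.cohomologyDeg n) :
      (toModule K ℤ _ s ∘ₗ (decomposeLinearEquiv A.cohomologyDeg).toLinearMap) x = s n ⟨x, hx⟩ := by
    change toModule K ℤ _ s (decompose A.cohomologyDeg x) = _
    rw [decompose_of_mem _ hx, ← lof_eq_of K, toModule_lof]
  refine ⟨toModule K ℤ _ s ∘ₗ (decomposeLinearEquiv A.cohomologyDeg).toLinearMap, fun x => ?_,
    fun n x hx => apply_of_mem n x hx ▸ (hs n ⟨x, hx⟩).1⟩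
  induction x using Decomposition.inductionOn A.cohomologyDeg with
  | zero => simp only [map_zero]
  | @homogeneous n x => rw [apply_of_mem n x x.2, (hs n x).2]
  | add x y hx hy => rw [map_add, map_add, hx, hy]

theorem isFormal_of_cohomology_concentrated_zero
    (hdeg : ∀ n ≠ 0, ∀ z ∈ A.deg n, A.d z = 0 → ∃ a, A.d a = z)
    (hzero : ∀ a, A.d a ∈ A.deg 0 → A.d a = 0) : A.IsFormal := by
  have eq_zero_of_ne (n : ℤ) (hn : n ≠ 0) (x) (hx : x ∈ A.cohomologyDeg n) : x = 0 := by
    obtain ⟨z, hz, rfl⟩ := hx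
    exact A.toCohomology_eq_zero.2 (hdeg n hn z hz z.2)
  obtain ⟨s, hs, hs_deg⟩ := A.exists_linear_section
    (fun n => (A.deg n).comap A.cocycles.val.toLinearMap) fun n x hx => hx
  have mem_cohomologyDeg_zero (x) : x ∈ A.cohomologyDeg 0 := by
    induction x using Decomposition.inductionOn A.cohomologyDeg with
    | zero => exact zero_mem _
    | @homogeneous n x =>
      obtain rfl | hn := eq_or_ne n 0
      · exact x.2
      · exact eq_zero_of_ne n hn x x.2 ▸ zero_mem _
    | add x y hx hy => exact add_mem hx hy
  have mem_deg_zero (x) : (s x : A.carrier) ∈ A.deg 0 := hs_deg 0 x (mem_cohomologyDeg_zero x)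
  have eq_of_class_eq (x y : A.cocycles) (hx : (x : A.carrier) ∈ A.deg 0)
      (hy : (y : A.carrier) ∈ A.deg 0) (hxy : A.toCohomology x = A.toCohomology y) : x = y := by
    obtain ⟨a, ha⟩ := toCohomology_eq_toCohomology_iff.1 hxy
    exact Subtype.ext (sub_eq_zero.1 (ha ▸ hzero a (ha ▸ sub_mem hx hy)))
  have one_mem : ((1 : A.cocycles) : A.carrier) ∈ A.deg 0 := SetLike.GradedOne.one_mem
  refine isFormal_of_section (AlgHom.ofLinearMap s ?_ fun x y => ?_) hs hs_deg
  · exact eq_of_class_eq _ _ (mem_deg_zero 1) one_mem (by rw [hs, toCohomology_one])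
  · have mul_mem : ((s x * s y : A.cocycles) : A.carrier) ∈ A.deg 0 := by
      simpa using SetLike.GradedMul.mul_mem (mem_deg_zero x) (mem_deg_zero y)
    exact eq_of_class_eq _ _ (mem_deg_zero _) mul_mem (by rw [toCohomology_mul, hs, hs, hs])

theorem exists_linear_section_map_one (hone : ¬ ∃ a, A.d a = 1)
    (Q : ℤ → Submodule K A.cocycles) (hQone : 1 ∈ Q 0)
    (hQ : ∀ n, ∀ x ∈ A.cohomologyDeg n, ∃ z ∈ Q n, A.toCohomology z = x) :
    ∃ s : A.CohomologyRing →ₗ[K] A.cocycles, s 1 = 1 ∧ (∀ x, A.toCohomology (s x) = x) ∧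
      ∀ n, ∀ x ∈ A.cohomologyDeg n, s x ∈ Q n := by
  obtain ⟨s, hs, hsQ⟩ := A.exists_linear_section Q hQ
  have one_mem : (1 : A.CohomologyRing) ∈ A.cohomologyDeg 0 :=
    SetLike.GradedOne.one_mem (A := A.cohomologyDeg)
  have one_ne_zero : (1 : A.CohomologyRing) ≠ 0 := fun h => hone (A.toCohomology_eq_zero.1 h)
  obtain ⟨φ, hφ⟩ := Module.Projective.exists_dual_eq_one K one_ne_zero
  let ψ : A.CohomologyRing →ₗ[K] K := φ ∘ₗ A.cohomologyComponent 0
  have hψ_one : ψ 1 = 1 := by simp [ψ, A.cohomologyComponent_same one_mem, hφ]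
  refine ⟨s + ψ.smulRight (1 - s 1), by simp [hψ_one], fun x => ?_, fun n x hx => ?_⟩
  · simp [hs, toCohomology_one]
  · refine add_mem (hsQ n x hx) ?_
    obtain rfl | hn := eq_or_ne n 0
    · exact Submodule.smul_mem _ _ (sub_mem hQone (hsQ 0 1 one_mem))
    · simp [ψ, A.cohomologyComponent_ne hn hx]

/-- On `K ⊕ N` with `N² = 0` a product is a linear expression in its factors: this is why any
linear section of `Z(A) → H(A)` with values in `K ⊕ N` that fixes `1` is multiplicative. -/
theorem exists_mul_eq_of_mem_one_sup {R : Type*} [Ring R] [Algebra K R] {N : Submodule K R}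
    (hN : ∀ a ∈ N, ∀ b ∈ N, a * b = 0) {a b : R} (ha : a ∈ 1 ⊔ N) (hb : b ∈ 1 ⊔ N) :
    ∃ k l : K, a * b = k • b + l • a - (k * l) • 1 := by
  obtain ⟨_, hk, x, hx, rfl⟩ := Submodule.mem_sup.1 ha
  obtain ⟨_, hl, y, hy, rfl⟩ := Submodule.mem_sup.1 hb
  obtain ⟨k, rfl⟩ := Submodule.mem_one.1 hk
  obtain ⟨l, rfl⟩ := Submodule.mem_one.1 hl
  refine ⟨k, l, ?_⟩
  simp only [Algebra.algebraMap_eq_smul_one, mul_add, add_mul, smul_mul_assoc, mul_smul_comm,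
    one_mul, mul_one, hN x hx y hy, smul_add, smul_smul, mul_comm l k]
  abel

theorem isFormal_of_mul_eq_zero (N : Submodule K A.carrier) (hN : ∀ a ∈ N, ∀ b ∈ N, a * b = 0)
    (hrep : ∀ n, ∀ z ∈ A.deg n, A.d z = 0 → ∃ y ∈ A.deg n, y ∈ 1 ⊔ N ∧ ∃ a, A.d a = z - y) :
    A.IsFormal := by
  by_cases hone : ∃ a, A.d a = 1
  · exact isFormal_of_one_mem_coboundaries hone
  have one_mem : (1 : A.carrier) ∈ A.deg 0 := SetLike.GradedOne.one_mem
  obtain ⟨s, hs_one, hs, hsQ⟩ := A.exists_linear_section_map_one hone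
    (fun n => (A.deg n ⊓ (1 ⊔ N)).comap A.cocycles.val.toLinearMap)
    ⟨one_mem, Submodule.mem_sup_left (Submodule.mem_one.2 ⟨1, map_one _⟩)⟩ (by
      rintro n _ ⟨z, hz, rfl⟩
      obtain ⟨y, hy, hyN, a, ha⟩ := hrep n z hz z.2
      have hdy : A.d y = 0 := by
        simpa [A.d_d, show A.d z = 0 from z.2] using congrArg A.d ha
      exact ⟨⟨y, hdy⟩, ⟨hy, hyN⟩, (toCohomology_eq_toCohomology_iff.2 ⟨a, ha⟩).symm⟩)
  have mem_one_sup (x) : (s x : A.carrier) ∈ 1 ⊔ N := by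
    induction x using Decomposition.inductionOn A.cohomologyDeg with
    | zero => simp
    | @homogeneous n x => exact (hsQ n x x.2).2
    | add x y hx hy => simpa using add_mem hx hy
  have map_mul (x y) : s (x * y) = s x * s y := by
    obtain ⟨k, l, hkl⟩ := exists_mul_eq_of_mem_one_sup hN (mem_one_sup x) (mem_one_sup y)
    have hkl : s x * s y = k • s y + l • s x - (k * l) • 1 := Subtype.ext hkl
    have hxy := congrArg A.toCohomology hkl
    simp only [toCohomology_mul, map_sub, map_add, map_smul, hs, toCohomology_one] at hxy
    rw [hxy, hkl, map_sub, map_add, map_smul, map_smul, map_smul, hs_one]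
  exact isFormal_of_section (AlgHom.ofLinearMap s hs_one map_mul) hs fun n x hx => (hsQ n x hx).1

theorem Hom.map_decompose (f : Hom A B) (a : A.carrier) (n : ℤ) :
    f.toAlgHom (decompose A.deg a n) = decompose B.deg (f.toAlgHom a) n :=
  ({ toRingHom := f.toAlgHom.toRingHom, map_mem := f.map_deg } :
    A.deg →+*ᵍ B.deg).map_directSumDecompose

theorem Hom.IsQuasiIso.exists_mem_deg {f : Hom A B} (hf : f.IsQuasiIso) {n : ℤ} {y : B.carrier}
    (hy : y ∈ B.deg n) (hdy : B.d y = 0) :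
    ∃ z ∈ A.deg n, A.d z = 0 ∧ ∃ b, B.d b = y - f.toAlgHom z := by
  obtain ⟨z, hz, b, hb⟩ := hf.2 y hdy
  refine ⟨decompose A.deg z n, SetLike.coe_mem _, A.d_component_eq_zero hz n,
    decompose B.deg b (n - 1), ?_⟩
  rw [← decompose_d, sub_add_cancel, hb, decompose_sub, f.map_decompose]
  exact congrArg (· - _) (decompose_of_mem_same B.deg hy)

theorem Hom.IsQuasiIso.isFormal_of_mul_eq_zero {f : Hom A B} (hf : f.IsQuasiIso)
    (N : Submodule K B.carrier) (hN : ∀ a ∈ N, ∀ b ∈ N, a * b = 0)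
    (hrep : ∀ n, ∀ z ∈ A.deg n, A.d z = 0 →
      ∃ y ∈ B.deg n, y ∈ 1 ⊔ N ∧ ∃ b, B.d b = f.toAlgHom z - y) : A.IsFormal := by
  refine .of_isQuasiIso hf (B.isFormal_of_mul_eq_zero N hN fun n y hy hdy => ?_)
  obtain ⟨z, hz, hdz, b, hb⟩ := hf.exists_mem_deg hy hdy
  obtain ⟨y', hy', hyN, c, hc⟩ := hrep n z hz hdz
  exact ⟨y', hy', hyN, b + c, by rw [map_add, hb, hc, sub_add_sub_cancel]⟩

end Formality

end DGAlgebra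

/-! ### Homotopy pullbacks -/

theorem isInternal_submodule_prod {R ι M N : Type*} [Ring R] [AddCommGroup M] [Module R M]
    [AddCommGroup N] [Module R N] [DecidableEq ι] {p : ι → Submodule R M} {q : ι → Submodule R N}
    (hp : IsInternal p) (hq : IsInternal q) : IsInternal fun i => (p i).prod (q i) := by
  refine isInternal_submodule_of_iSupIndep_of_iSup_eq_top (fun i => ?_) ?_
  · have hle : ⨆ (j) (_ : j ≠ i), (p j).prod (q j) ≤
        (⨆ (j) (_ : j ≠ i), p j).prod (⨆ (j) (_ : j ≠ i), q j) :=
      iSup₂_le fun j hj => Submodule.prod_mono (le_iSup₂_of_le j hj le_rfl)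
        (le_iSup₂_of_le j hj le_rfl)
    refine Disjoint.mono_right hle (disjoint_iff.2 ?_)
    rw [Submodule.prod_inf_prod, (hp.submodule_iSupIndep i).eq_bot,
      (hq.submodule_iSupIndep i).eq_bot, Submodule.prod_bot]
  · rw [eq_top_iff, ← Submodule.prod_top, ← hp.submodule_iSup_eq_top,
      ← hq.submodule_iSup_eq_top, Submodule.prod_le_iff, Submodule.map_iSup, Submodule.map_iSup]
    refine ⟨iSup_mono fun i => ?_, iSup_mono fun i => ?_⟩
    · exact Submodule.map_le_iff_le_comap.2 fun a ha => ⟨ha, zero_mem _⟩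
    · exact Submodule.map_le_iff_le_comap.2 fun b hb => ⟨zero_mem _, hb⟩

theorem isInternal_submodule_comp {R ι κ M : Type*} [Ring R] [AddCommGroup M] [Module R M]
    [DecidableEq ι] [DecidableEq κ] {p : ι → Submodule R M} (hp : IsInternal p) (e : κ ≃ ι) :
    IsInternal fun k => p (e k) :=
  isInternal_submodule_of_iSupIndep_of_iSup_eq_top (hp.submodule_iSupIndep.comp e.injective)
    ((e.iSup_comp (g := p)).trans hp.submodule_iSup_eq_top)

namespace DGAlgebra

variable {K : Type v} [Field K] {A B C : DGAlgebra.{v, w} K}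

section Sign

/-- The algebra automorphism multiplying the elements of degree `n` by `(-1) ^ n`. It makes the
signs in the Leibniz rule and in homotopy pullbacks available for non-homogeneous elements. -/
noncomputable def sign (A : DGAlgebra.{v, w} K) : A.carrier →ₐ[K] A.carrier :=
  (toAlgebra K (fun n => A.deg n)
    (fun n => (n.negOnePow : ℤ) • (A.deg n).subtype) (by simp [GradedMonoid.GOne.one])
    (fun {i j} a b => by
      simp only [GradedMonoid.GMul.mul, LinearMap.smul_apply, Submodule.subtype_apply]
      rw [smul_mul_smul_comm, Int.negOnePow_add, Units.val_mul])).comp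
    (decomposeAlgEquiv A.deg).toAlgHom

theorem sign_of_mem {n : ℤ} {a : A.carrier} (ha : a ∈ A.deg n) :
    A.sign a = n.negOnePow • a := by
  change toModule K ℤ _ _ (decompose A.deg a) = _
  rw [decompose_of_mem _ ha, ← lof_eq_of K, toModule_lof]
  rfl

theorem d_mul (a b : A.carrier) : A.d (a * b) = A.d a * b + A.sign a * A.d b := by
  induction a using Decomposition.inductionOn A.deg with
  | zero => simp
  | homogeneous a => rw [A.leibniz a.2, sign_of_mem a.2, smul_mul_assoc]
  | add a a' h h' => rw [add_mul, map_add, h, h', map_add, map_add, add_mul, add_mul]; abel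

theorem sign_d (a : A.carrier) : A.sign (A.d a) = -A.d (A.sign a) := by
  induction a using Decomposition.inductionOn A.deg with
  | zero => simp
  | homogeneous a =>
    rw [sign_of_mem (A.d_mem a.2), sign_of_mem a.2, Int.negOnePow_succ, Units.smul_def,
      Units.smul_def, map_zsmul, Units.val_neg, neg_smul]
  | add a a' h h' => simp [h, h', add_comm]

end Sign

/-- `C` as a bimodule over `A × B`, for dg-algebra morphisms `f : A → C` and `g : B → C`: elements
`(a, b)` act from the left by `±f a`, with the sign given by the degree of `a`, and from the right
by `g b`. -/
def PullbackBimodule (_f : Hom A C) (_g : Hom B C) : Type w := C.carrier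

namespace PullbackBimodule

variable (f : Hom A C) (g : Hom B C)

instance : AddCommGroup (PullbackBimodule f g) := inferInstanceAs (AddCommGroup C.carrier)

instance : Module K (PullbackBimodule f g) := inferInstanceAs (Module K C.carrier)

noncomputable instance : Module (A.carrier × B.carrier) (PullbackBimodule f g) :=
  Module.compHom C.carrier
    ((C.sign.comp f.toAlgHom).toRingHom.comp (RingHom.fst A.carrier B.carrier))

instance : Module (A.carrier × B.carrier)ᵐᵒᵖ (PullbackBimodule f g) :=
  Module.compHom C.carrier (g.toAlgHom.toRingHom.comp (RingHom.snd A.carrier B.carrier)).op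

instance : SMulCommClass (A.carrier × B.carrier) (A.carrier × B.carrier)ᵐᵒᵖ
    (PullbackBimodule f g) where
  smul_comm r s m := (mul_assoc (C.sign (f.toAlgHom r.1)) m (g.toAlgHom s.unop.2)).symm

instance : IsScalarTower K (A.carrier × B.carrier) (PullbackBimodule f g) where
  smul_assoc k r m :=
    (congrArg (· * (show C.carrier from m)) (map_smul (C.sign.comp f.toAlgHom) k r.1)).trans
      (smul_mul_assoc k (C.sign (f.toAlgHom r.1)) (show C.carrier from m))

instance : IsScalarTower K (A.carrier × B.carrier)ᵐᵒᵖ (PullbackBimodule f g) where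
  smul_assoc k r m :=
    (congrArg ((show C.carrier from m) * ·) (map_smul g.toAlgHom k r.unop.2)).trans
      (mul_smul_comm k (show C.carrier from m) (g.toAlgHom r.unop.2))

end PullbackBimodule

namespace HomotopyPullback

variable (f : Hom A C) (g : Hom B C)

/-- The underlying algebra of the homotopy pullback of `f` and `g`, a square-zero extension of
`A × B`: its elements are triples `((a, b), m)`, multiplied by
`((a, b), m) * ((a', b'), m') = ((a * a', b * b'), ± f a * m' + m * g b')`. -/
abbrev Carrier : Type w := TrivSqZeroExt (A.carrier × B.carrier) (PullbackBimodule f g)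

variable {f g}

/-- The component in `A`. -/
noncomputable def left : Carrier f g →ₐ[K] A.carrier :=
  (AlgHom.fst K A.carrier B.carrier).comp (TrivSqZeroExt.fstHom K _ _)

/-- The component in `B`. -/
noncomputable def right : Carrier f g →ₐ[K] B.carrier :=
  (AlgHom.snd K A.carrier B.carrier).comp (TrivSqZeroExt.fstHom K _ _)

/-- The component in `C`, a homotopy between the images of the other two components. -/
noncomputable def link : Carrier f g →ₗ[K] C.carrier :=
  LinearMap.snd K (A.carrier × B.carrier) C.carrier

/-- The element with given components. -/
def mk (a : A.carrier) (b : B.carrier) (m : C.carrier) : Carrier f g := ((a, b), m)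

@[ext]
theorem ext {x y : Carrier f g} (hleft : left x = left y) (hright : right x = right y)
    (hlink : link x = link y) : x = y :=
  TrivSqZeroExt.ext (Prod.ext hleft hright) hlink

@[simp]
theorem left_mk (a : A.carrier) (b : B.carrier) (m : C.carrier) :
    left (mk a b m : Carrier f g) = a := rfl

@[simp]
theorem right_mk (a : A.carrier) (b : B.carrier) (m : C.carrier) :
    right (mk a b m : Carrier f g) = b := rfl

@[simp]
theorem link_mk (a : A.carrier) (b : B.carrier) (m : C.carrier) :
    link (mk a b m : Carrier f g) = m := rfl

@[simp]
theorem link_mul (x y : Carrier f g) :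
    link (x * y) = C.sign (f.toAlgHom (left x)) * link y + link x * g.toAlgHom (right y) := rfl

variable (f g) in
/-- The elements `((a, b), m)` with `a` and `b` of degree `n` and `m` of degree `n - 1`. -/
def grading (n : ℤ) : Submodule K (Carrier f g) :=
  ((A.deg n).prod (B.deg n)).prod (C.deg (n - 1))

theorem mem_grading {n : ℤ} {x : Carrier f g} :
    x ∈ grading f g n ↔ left x ∈ A.deg n ∧ right x ∈ B.deg n ∧ link x ∈ C.deg (n - 1) :=
  and_assoc

theorem isInternal_grading : IsInternal (grading f g) :=
  isInternal_submodule_prod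
    (isInternal_submodule_prod (Decomposition.isInternal A.deg) (Decomposition.isInternal B.deg))
    (isInternal_submodule_comp (Decomposition.isInternal C.deg) (Equiv.subRight 1))

noncomputable instance : GradedAlgebra (grading f g) where
  one_mem := mem_grading.2 ⟨by simpa using SetLike.GradedOne.one_mem,
    by simpa using SetLike.GradedOne.one_mem, zero_mem _⟩
  mul_mem i j x y hx hy := by
    rw [mem_grading] at hx hy
    refine mem_grading.2 ⟨?_, ?_, ?_⟩
    · simpa using SetLike.GradedMul.mul_mem hx.1 hy.1
    · simpa using SetLike.GradedMul.mul_mem hx.2.1 hy.2.1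
    · have hleft := SetLike.GradedMul.mul_mem (f.map_deg hx.1) hy.2.2
      have hright := SetLike.GradedMul.mul_mem hx.2.2 (g.map_deg hy.2.1)
      rw [link_mul, sign_of_mem (f.map_deg hx.1), smul_mul_assoc, Units.smul_def]
      rw [show i + (j - 1) = i + j - 1 by ring] at hleft
      rw [show i - 1 + j = i + j - 1 by ring] at hright
      exact add_mem (zsmul_mem hleft _) hright
  toDecomposition := isInternal_grading.chooseDecomposition

/-- The differential `((a, b), m) ↦ ((d a, d b), f a - g b - d m)`. -/
noncomputable def differential : Carrier f g →ₗ[K] Carrier f g where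
  toFun x := mk (A.d (left x)) (B.d (right x))
    (f.toAlgHom (left x) - g.toAlgHom (right x) - C.d (link x))
  map_add' x y := by ext <;> simp; abel
  map_smul' k x := by ext <;> simp [smul_sub]

end HomotopyPullback

open HomotopyPullback in
/-- The homotopy pullback of `f : A → C` and `g : B → C`. -/
noncomputable def homotopyPullback (f : Hom A C) (g : Hom B C) : DGAlgebra.{v, w} K where
  carrier := Carrier f g
  deg := grading f g
  d := differential
  d_mem {n x} hx := by
    rw [mem_grading] at hx
    have hleft := f.map_deg hx.1
    have hright := g.map_deg hx.2.1
    have hlink := C.d_mem hx.2.2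
    rw [sub_add_cancel] at hlink
    refine mem_grading.2 ⟨A.d_mem hx.1, B.d_mem hx.2.1, ?_⟩
    simpa [differential] using sub_mem (sub_mem hleft hright) hlink
  d_d x := by ext <;> simp [differential, A.d_d, B.d_d, C.d_d, f.map_d, g.map_d]
  leibniz {n x} hx y := by
    rw [mem_grading] at hx
    have hsign := sign_of_mem (f.map_deg hx.1)
    have hsign_d := C.sign_d (f.toAlgHom (left x))
    have hsign_link := sign_of_mem hx.2.2
    rw [Int.negOnePow_sub, Int.negOnePow_one] at hsign_link
    ext
    · simp [differential, A.leibniz hx.1, Units.smul_def]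
    · simp [differential, B.leibniz hx.2.1, Units.smul_def]
    · obtain hn | hn := Int.units_eq_one_or n.negOnePow <;>
      · rw [hn] at hsign hsign_link
        simp only [differential, LinearMap.coe_mk, AddHom.coe_mk, left_mk, right_mk, link_mk,
          link_mul, map_mul, map_add, map_neg, d_mul, f.map_d, g.map_d, hsign, hsign_d, hsign_link,
          hn, Units.neg_smul, one_smul, mul_one, mul_neg, neg_mul, neg_neg, mul_sub, sub_mul]
        abel

namespace HomotopyPullback

variable {f : Hom A C} {g : Hom B C}

theorem homotopyPullback_d (a : A.carrier) (b : B.carrier) (m : C.carrier) :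
    (homotopyPullback f g).d (mk a b m) =
      mk (A.d a) (B.d b) (f.toAlgHom a - g.toAlgHom b - C.d m) := rfl

variable (f g) in
/-- The square-zero ideal of the elements `((0, 0), m)`. -/
noncomputable def links : Submodule K (homotopyPullback f g).carrier :=
  LinearMap.ker (TrivSqZeroExt.fstHom K (A.carrier × B.carrier) (PullbackBimodule f g)).toLinearMap

theorem mul_eq_zero_of_mem_links {x y : (homotopyPullback f g).carrier} (hx : x ∈ links f g)
    (hy : y ∈ links f g) : x * y = 0 := by
  rw [← TrivSqZeroExt.inl_fst_add_inr_snd_eq x, ← TrivSqZeroExt.inl_fst_add_inr_snd_eq y,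
    show TrivSqZeroExt.fst x = 0 from hx, show TrivSqZeroExt.fst y = 0 from hy,
    TrivSqZeroExt.inl_zero, zero_add, zero_add]
  exact TrivSqZeroExt.inr_mul_inr ..

/-- The morphism `s ↦ ((p s, q s), 0)` into the homotopy pullback of `f` and `g` given by a
commutative square `f p = g q`. -/
noncomputable def lift {S : DGAlgebra.{v, w} K} (p : Hom S A) (q : Hom S B)
    (hpq : ∀ s, f.toAlgHom (p.toAlgHom s) = g.toAlgHom (q.toAlgHom s)) :
    Hom S (homotopyPullback f g) where
  toAlgHom := (TrivSqZeroExt.inlAlgHom K (A.carrier × B.carrier) (PullbackBimodule f g)).comp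
    (p.toAlgHom.prod q.toAlgHom)
  map_deg hs := mem_grading.2 ⟨p.map_deg hs, q.map_deg hs, zero_mem _⟩
  map_d s := by
    change mk (p.toAlgHom (S.d s)) (q.toAlgHom (S.d s)) 0 =
      mk (A.d (p.toAlgHom s)) (B.d (q.toAlgHom s))
        (f.toAlgHom (p.toAlgHom s) - g.toAlgHom (q.toAlgHom s) - C.d 0)
    rw [p.map_d, q.map_d, hpq, sub_self, map_zero, sub_zero]

theorem exists_apply_eq_sub_d {S : DGAlgebra.{v, w} K} {p : Hom S A} {q : Hom S B}
    (hf : Function.Surjective f.toAlgHom)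
    (glue : ∀ a b, f.toAlgHom a = g.toAlgHom b → ∃ s, p.toAlgHom s = a ∧ q.toAlgHom s = b)
    {a : A.carrier} {b : B.carrier} {m : C.carrier}
    (hm : f.toAlgHom a - g.toAlgHom b - C.d m = 0) :
    ∃ c s, f.toAlgHom c = m ∧ p.toAlgHom s = a - A.d c ∧ q.toAlgHom s = b := by
  obtain ⟨c, rfl⟩ := hf m
  obtain ⟨s, hsa, hsb⟩ := glue (a - A.d c) b (by
    rw [map_sub, f.map_d, ← sub_eq_zero, sub_right_comm, hm])
  exact ⟨c, s, rfl, hsa, hsb⟩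

theorem lift_isQuasiIso {S : DGAlgebra.{v, w} K} {p : Hom S A} {q : Hom S B}
    {hpq : ∀ s, f.toAlgHom (p.toAlgHom s) = g.toAlgHom (q.toAlgHom s)}
    (hf : Function.Surjective f.toAlgHom)
    (glue : ∀ a b, f.toAlgHom a = g.toAlgHom b → ∃ s, p.toAlgHom s = a ∧ q.toAlgHom s = b)
    (acyclic : ∀ s, p.toAlgHom s = 0 → q.toAlgHom s = 0 → S.d s = 0 →
      ∃ t, p.toAlgHom t = 0 ∧ q.toAlgHom t = 0 ∧ S.d t = s) :
    (lift p q hpq).IsQuasiIso := by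
  constructor
  · rintro s hs ⟨x, hx⟩
    have hx_left : A.d (left x) = p.toAlgHom s := congrArg left hx
    have hx_right : B.d (right x) = q.toAlgHom s := congrArg right hx
    obtain ⟨c, u, -, hu_left, hu_right⟩ := exists_apply_eq_sub_d hf glue (congrArg link hx)
    obtain ⟨t, -, -, ht⟩ := acyclic (s - S.d u)
      (by rw [map_sub, p.map_d, hu_left, map_sub, A.d_d, hx_left, sub_zero, sub_self])
      (by rw [map_sub, q.map_d, hu_right, hx_right, sub_self])
      (by rw [map_sub, hs, S.d_d, sub_zero])
    exact ⟨t + u, by rw [map_add, ht, sub_add_cancel]⟩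
  · intro y hy
    have hy_left : A.d (left y) = 0 := congrArg left hy
    have hy_right : B.d (right y) = 0 := congrArg right hy
    obtain ⟨c, u, hc, hu_left, hu_right⟩ := exists_apply_eq_sub_d hf glue (congrArg link hy)
    obtain ⟨t, ht_left, ht_right, ht⟩ := acyclic (S.d u)
      (by rw [p.map_d, hu_left, map_sub, A.d_d, hy_left, sub_zero])
      (by rw [q.map_d, hu_right, hy_right]) (S.d_d u)
    refine ⟨u - t, by rw [map_sub, ht, sub_self], mk c 0 0, ?_⟩
    refine ext (f := f) (g := g) ?_ ?_ ?_
    · change A.d c = left y - p.toAlgHom (u - t)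
      rw [map_sub, ht_left, hu_left, sub_zero, sub_sub_cancel]
    · change B.d 0 = right y - q.toAlgHom (u - t)
      rw [map_sub, ht_right, hu_right, sub_zero, sub_self, map_zero]
    · change f.toAlgHom c - g.toAlgHom 0 - C.d 0 = link y - 0
      rw [hc, map_zero, map_zero, sub_zero]

end HomotopyPullback

end DGAlgebra

/-! ### Functoriality and homotopy invariance of cochains -/

namespace SSetCochain

open Opposite AlgebraicTopology

variable {S T : SSet.{u}} {K : Type v} [Field K]

/-- The pullback of cochains along a map of simplicial sets. -/
def pullback (φ : S ⟶ T) (n : ℕ) : SSetCochain T K n →ₗ[K] SSetCochain S K n :=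
  LinearMap.funLeft K K (φ.app (op ⦋n⦌))

theorem pullback_apply (φ : S ⟶ T) {n : ℕ} (f : SSetCochain T K n) (σ : S _⦋n⦌) :
    pullback φ n f σ = f (φ.app _ σ) := rfl

theorem coboundary_pullback (φ : S ⟶ T) (n : ℕ) (f : SSetCochain T K n) :
    coboundary n (pullback φ n f) = pullback φ (n + 1) (coboundary n f) := by
  funext σ
  simp only [pullback_apply, coboundary_apply, NatTrans.naturality_apply]

theorem pullback_cup (φ : S ⟶ T) {p q : ℕ} (f : SSetCochain T K p) (g : SSetCochain T K q) :
    pullback φ (p + q) (cup f g) = cup (pullback φ p f) (pullback φ q g) := by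
  funext σ
  simp only [cup, pullback_apply, NatTrans.naturality_apply]

/-- The functor `W ↦ (W → K)`, whose composition with a simplicial set is its cosimplicial module of
cochains. -/
def functions (K : Type v) [Field K] : Type u ⥤ (ModuleCat.{max u v} K)ᵒᵖ where
  obj W := op (ModuleCat.of K (W → K))
  map φ := (ModuleCat.ofHom (LinearMap.funLeft K K φ)).op

theorem alternatingFaceMapComplex_functions_d (S : SSet.{u}) (n : ℕ) :
    ((alternatingFaceMapComplex _).obj
      (((SimplicialObject.whiskering _ _).obj (functions K)).obj S)).d (n + 1) n =
    (ModuleCat.ofHom (coboundary (S := S) (K := K) n)).op := by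
  rw [alternatingFaceMapComplex_obj_d]
  refine Quiver.Hom.unop_inj (ModuleCat.hom_ext ?_)
  rw [AlternatingFaceMapComplex.objD, unop_sum, ModuleCat.hom_sum]
  refine LinearMap.ext fun f => funext fun σ => ?_
  rw [LinearMap.sum_apply]
  refine (Finset.sum_apply _ _ _).trans (Finset.sum_congr rfl fun i _ => ?_)
  rw [unop_zsmul, ModuleCat.hom_zsmul]
  refine (zsmul_eq_mul _ _).trans ?_
  push_cast
  rfl

theorem exists_homotopy_formula {φ ψ : S ⟶ T} (H : SSet.Homotopy φ ψ) :
    ∃ P : ∀ n, SSetCochain T K (n + 1) →ₗ[K] SSetCochain S K n,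
      pullback φ 0 = P 0 ∘ₗ coboundary 0 + pullback ψ 0 ∧
      ∀ n, pullback φ (n + 1) =
        coboundary n ∘ₗ P n + P (n + 1) ∘ₗ coboundary (n + 1) + pullback ψ (n + 1) := by
  let L := (H.toSimplicialObjectHomotopy.whiskerRight (functions K)).toChainHomotopy
  refine ⟨fun n => (L.hom n (n + 1)).unop.hom, ?_, fun n => ?_⟩
  · have comm := L.comm 0
    rw [dNext_eq_zero _ _ (by simp), zero_add, prevD_eq (j' := 1) (w := by simp),
      alternatingFaceMapComplex_functions_d] at comm
    exact congrArg (fun l => l.unop.hom) comm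
  · have comm := L.comm (n + 1)
    rw [dNext_eq (i' := n) (w := by simp), prevD_eq (j' := n + 2) (w := by simp),
      alternatingFaceMapComplex_functions_d, alternatingFaceMapComplex_functions_d] at comm
    exact congrArg (fun l => l.unop.hom) comm

/-- The algebra map on total cochains induced by a map of simplicial sets. -/
noncomputable def pullbackAlgHom (φ : S ⟶ T) (K : Type v) [Field K] :
    (⨁ n, SSetCochain T K n) →ₐ[K] ⨁ n, SSetCochain S K n :=
  toAlgebra K (SSetCochain T K) (fun n => lof K ℕ (SSetCochain S K) n ∘ₗ pullback φ n) rfl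
    fun {p q} f g => by
      change of (SSetCochain S K) (p + q) (pullback φ (p + q) (cup f g)) = _
      rw [pullback_cup]
      exact (of_mul_of _ _).symm

theorem pullbackAlgHom_of (φ : S ⟶ T) {n : ℕ} (f : SSetCochain T K n) :
    pullbackAlgHom φ K (of _ n f) = of _ n (pullback φ n f) :=
  toAddMonoid_of (fun k => (lof K ℕ (SSetCochain S K) k ∘ₗ pullback φ k).toAddMonoidHom) n f

/-- The morphism of cochain algebras induced by a map of simplicial sets. -/
noncomputable def pullbackHom (φ : S ⟶ T) (K : Type v) [Field K] :
    DGAlgebra.Hom (cochainAlgebra T K) (cochainAlgebra S K) where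
  toAlgHom := pullbackAlgHom φ K
  map_deg {k x} hx := by
    obtain rfl | ⟨n, f, rfl, rfl⟩ := eq_of_mem_degree hx
    · exact (map_zero (pullbackAlgHom φ K)).symm ▸ zero_mem _
    · exact (pullbackAlgHom_of φ f).symm ▸ of_mem_degree n _
  map_d x := by
    change pullbackAlgHom φ K (totalCoboundary T K x) =
      totalCoboundary S K (pullbackAlgHom φ K x)
    induction x using DirectSum.induction_on with
    | zero => simp only [map_zero]
    | of n f => rw [totalCoboundary_of, pullbackAlgHom_of, pullbackAlgHom_of, totalCoboundary_of,
        coboundary_pullback]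
    | add x y hx hy => simp only [map_add, hx, hy]

theorem exists_coboundary_eq_pullback_const (x : T _⦋0⦌) (n : ℕ) (f : SSetCochain T K (n + 1))
    (hf : coboundary (n + 1) f = 0) :
    ∃ h, coboundary n h = pullback (SSet.const x : S ⟶ T) (n + 1) f := by
  let c : K := f (T.map (SimplexCategory.const ⦋n + 1⦌ ⦋0⦌ 0).op x)
  have pullback_eq : pullback (SSet.const x : S ⟶ T) (n + 1) f = fun _ => c := rfl
  have c_mul : (if Even (n + 3) then 0 else 1) * c = 0 := by
    have hfx : coboundary (n + 1) f (T.map (SimplexCategory.const ⦋n + 2⦌ ⦋0⦌ 0).op x) = 0 :=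
      congrFun hf _
    rw [← Fin.sum_neg_one_pow, Finset.sum_mul, ← hfx, coboundary_apply]
    refine Finset.sum_congr rfl fun i _ => ?_
    rw [map_map]
    rfl
  obtain heven | hodd := Nat.even_or_odd (n + 3)
  · refine ⟨fun _ => c, funext fun σ => ?_⟩
    rw [pullback_eq, coboundary_apply, ← Finset.sum_mul, Fin.sum_neg_one_pow,
      if_neg (by grind), one_mul]
  · rw [if_neg (Nat.not_even_iff_odd.2 hodd), one_mul] at c_mul
    exact ⟨0, by rw [pullback_eq, c_mul, map_zero]; rfl⟩

end SSetCochain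

section Nullhomotopic

open Opposite SSetCochain

variable {W X : TopCat.{u}} {K : Type v} [Field K] {φ : W ⟶ X}

theorem exists_coboundary_eq_pullback_of_nullhomotopic (hφ : φ.hom.Nullhomotopic) (n : ℕ)
    (f : SSetCochain (TopCat.toSSet.obj X) K (n + 1)) (hf : coboundary (n + 1) f = 0) :
    ∃ h, coboundary n h = pullback (TopCat.toSSet.map φ) (n + 1) f := by
  obtain ⟨x, ⟨H⟩⟩ := hφ
  obtain ⟨P, -, hP⟩ := exists_homotopy_formula (K := K)
    (TopCat.Homotopy.toSSet (f := φ) (g := TopCat.const x) H)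
  obtain ⟨h, hh⟩ := exists_coboundary_eq_pullback_const (S := TopCat.toSSet.obj W)
    (TopCat.toSSetObj₀Equiv.symm x) n f hf
  refine ⟨P n f + h, ?_⟩
  rw [hP, TopCat.toSSet_map_const, map_add, hh]
  simp [hf]

theorem exists_pullback_eq_const_of_nullhomotopic (hφ : φ.hom.Nullhomotopic)
    (f : SSetCochain (TopCat.toSSet.obj X) K 0) (hf : coboundary 0 f = 0) :
    ∃ k, pullback (TopCat.toSSet.map φ) 0 f = fun _ => k := by
  obtain ⟨x, ⟨H⟩⟩ := hφ
  obtain ⟨P, hP, -⟩ := exists_homotopy_formula (K := K)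
    (TopCat.Homotopy.toSSet (f := φ) (g := TopCat.const x) H)
  rw [hP, TopCat.toSSet_map_const, LinearMap.add_apply, LinearMap.comp_apply, hf, map_zero,
    zero_add]
  exact ⟨f ((TopCat.toSSet.obj X).map (SimplexCategory.const ⦋0⦌ ⦋0⦌ 0).op
    (TopCat.toSSetObj₀Equiv.symm x)), rfl⟩

end Nullhomotopic

/-! ### Subdivision -/

/-- Ordered simplicial chains on the points of `P`, indexed by the number of vertices: the case
`k = 0` is the augmentation, which makes the cone formulas uniform. -/
abbrev OrderedChain (R P : Type*) [Ring R] (k : ℕ) : Type _ :=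
  (Fin k → P) →₀ R

namespace OrderedChain

variable {R P Q M : Type*} [Ring R] [AddCommGroup M] [Module R M] {k : ℕ}

theorem hom_ext {f g : OrderedChain R P k →ₗ[R] M}
    (h : ∀ v, f (Finsupp.single v 1) = g (Finsupp.single v 1)) : f = g :=
  Finsupp.lhom_ext' fun v => LinearMap.ext_ring (h v)

/-- The alternating sum of the faces. -/
noncomputable def boundary : OrderedChain R P (k + 1) →ₗ[R] OrderedChain R P k :=
  Finsupp.linearCombination R fun v =>
    ∑ i : Fin (k + 1), (-1 : R) ^ (i : ℕ) • Finsupp.single (v ∘ i.succAbove) 1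

theorem boundary_single (v : Fin (k + 1) → P) :
    boundary (Finsupp.single v (1 : R)) =
      ∑ i : Fin (k + 1), (-1 : R) ^ (i : ℕ) • Finsupp.single (v ∘ i.succAbove) 1 := by
  rw [boundary, Finsupp.linearCombination_single, one_smul]

/-- The cone with apex `b`, which becomes the first vertex. -/
noncomputable def cone (b : P) : OrderedChain R P k →ₗ[R] OrderedChain R P (k + 1) :=
  Finsupp.lmapDomain R R fun v => Fin.cons b v

theorem cone_single (b : P) (v : Fin k → P) :
    cone b (Finsupp.single v (1 : R)) = Finsupp.single (Fin.cons b v) 1 :=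
  Finsupp.mapDomain_single

theorem boundary_cone_zero (b : P) (x : OrderedChain R P 0) : boundary (cone b x) = x := by
  refine LinearMap.congr_fun (f := boundary ∘ₗ cone b) (g := .id) (hom_ext fun v => ?_) x
  rw [LinearMap.comp_apply, cone_single, boundary_single, Fin.sum_univ_one, Fin.val_zero, pow_zero,
    one_smul, Subsingleton.elim (_ ∘ _) v, LinearMap.id_apply]

theorem boundary_cone (b : P) (x : OrderedChain R P (k + 1)) :
    boundary (cone b x) = x - cone b (boundary x) := by
  refine LinearMap.congr_fun (f := boundary ∘ₗ cone b) (g := .id - cone b ∘ₗ boundary)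
    (hom_ext fun v => ?_) x
  have face_cons (i : Fin (k + 1)) :
      (Fin.cons b v : Fin (k + 2) → P) ∘ i.succ.succAbove = Fin.cons b (v ∘ i.succAbove) :=
    funext fun j => Fin.cases (by simp) (by simp) j
  simp only [LinearMap.comp_apply, LinearMap.sub_apply, LinearMap.id_apply, cone_single,
    boundary_single, map_sum, map_smul]
  rw [Fin.sum_univ_succ, Fin.val_zero, pow_zero, one_smul, sub_eq_add_neg,
    ← Finset.sum_neg_distrib]
  refine congrArg₂ _ rfl (Finset.sum_congr rfl fun i _ => ?_)
  rw [face_cons, Fin.val_succ, pow_succ, mul_neg_one, neg_smul]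

theorem boundary_boundary {k : ℕ} (x : OrderedChain R P (k + 2)) : boundary (boundary x) = 0 := by
  suffices h : ∀ v : Fin (k + 2) → P, boundary (boundary (Finsupp.single v (1 : R))) = 0 from
    LinearMap.congr_fun (f := boundary ∘ₗ boundary) (g := 0) (hom_ext h) x
  intro v
  rw [← Fin.cons_self_tail v, ← cone_single, boundary_cone, map_sub]
  cases k with
  | zero => rw [boundary_cone_zero, sub_self]
  | succ k => rw [boundary_cone, boundary_boundary, map_zero, sub_zero, sub_self]

section Map

/-- The map on chains induced by a map of points. -/
noncomputable def map (R : Type*) [Ring R] (φ : P → Q) (k : ℕ) :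
    OrderedChain R P k →ₗ[R] OrderedChain R Q k :=
  Finsupp.lmapDomain R R fun v => φ ∘ v

theorem map_single (φ : P → Q) (v : Fin k → P) :
    map R φ k (Finsupp.single v 1) = Finsupp.single (φ ∘ v) 1 :=
  Finsupp.mapDomain_single

theorem map_boundary (φ : P → Q) (x : OrderedChain R P (k + 1)) :
    map R φ k (boundary x) = boundary (map R φ (k + 1) x) := by
  refine LinearMap.congr_fun (f := map R φ k ∘ₗ boundary) (g := boundary ∘ₗ map R φ (k + 1))
    (hom_ext fun v => ?_) x
  simp only [LinearMap.comp_apply, map_single, boundary_single, map_sum, map_smul]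
  rfl

theorem map_cone (φ : P → Q) (b : P) (x : OrderedChain R P k) :
    map R φ (k + 1) (cone b x) = cone (φ b) (map R φ k x) := by
  refine LinearMap.congr_fun (f := map R φ (k + 1) ∘ₗ cone b) (g := cone (φ b) ∘ₗ map R φ k)
    (hom_ext fun v => ?_) x
  simp only [LinearMap.comp_apply, map_single, cone_single]
  congr 1
  exact funext fun j => Fin.cases rfl (fun _ => rfl) j

end Map

/-- The subdivision operator that cones off the subdivided boundary of a simplex `v` from `c v`. -/
noncomputable def subdiv (c : ∀ {k : ℕ}, (Fin (k + 1) → P) → P) :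
    ∀ k, OrderedChain R P k →ₗ[R] OrderedChain R P k := fun k => match k with
  | 0 => .id
  | k + 1 => Finsupp.linearCombination R fun v =>
      cone (c v) (subdiv c k (boundary (Finsupp.single v 1)))

/-- The chain homotopy between the identity and `subdiv`. -/
noncomputable def homotopy (c : ∀ {k : ℕ}, (Fin (k + 1) → P) → P) :
    ∀ k, OrderedChain R P k →ₗ[R] OrderedChain R P (k + 1) := fun k => match k with
  | 0 => 0
  | k + 1 => Finsupp.linearCombination R fun v =>
      cone (c v) (Finsupp.single v 1 - homotopy c k (boundary (Finsupp.single v 1)))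

section Subdivision

variable (c : ∀ {k : ℕ}, (Fin (k + 1) → P) → P)

theorem subdiv_single (v : Fin (k + 1) → P) :
    subdiv c (k + 1) (Finsupp.single v (1 : R)) =
      cone (c v) (subdiv c k (boundary (Finsupp.single v 1))) := by
  rw [subdiv, Finsupp.linearCombination_single, one_smul]

theorem homotopy_single (v : Fin (k + 1) → P) :
    homotopy c (k + 1) (Finsupp.single v (1 : R)) =
      cone (c v) (Finsupp.single v 1 - homotopy c k (boundary (Finsupp.single v 1))) := by
  rw [homotopy, Finsupp.linearCombination_single, one_smul]

theorem boundary_homotopy {k : ℕ} (x : OrderedChain R P (k + 1)) :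
    boundary (homotopy c (k + 1) x) = x - subdiv c (k + 1) x - homotopy c k (boundary x) := by
  refine LinearMap.congr_fun (f := boundary ∘ₗ homotopy c (k + 1))
    (g := .id - subdiv c (k + 1) - homotopy c k ∘ₗ boundary) (hom_ext fun v => ?_) x
  simp only [LinearMap.comp_apply, LinearMap.sub_apply, LinearMap.id_apply]
  rw [homotopy_single, boundary_cone, subdiv_single, map_sub]
  cases k with
  | zero => simp [homotopy, subdiv]
  | succ k =>
    rw [boundary_homotopy, boundary_boundary, map_zero, sub_zero, sub_sub_cancel]
    abel

theorem boundary_subdiv {k : ℕ} (x : OrderedChain R P (k + 1)) :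
    boundary (subdiv c (k + 1) x) = subdiv c k (boundary x) := by
  refine LinearMap.congr_fun (f := boundary ∘ₗ subdiv c (k + 1)) (g := subdiv c k ∘ₗ boundary)
    (hom_ext fun v => ?_) x
  rw [LinearMap.comp_apply, LinearMap.comp_apply, subdiv_single]
  cases k with
  | zero => rw [boundary_cone_zero]
  | succ k => rw [boundary_cone, boundary_subdiv, boundary_boundary, map_zero, map_zero, sub_zero]

theorem boundary_subdiv_pow (N : ℕ) (x : OrderedChain R P (k + 1)) :
    boundary ((subdiv c (k + 1) ^ N) x) = (subdiv c k ^ N) (boundary x) := by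
  induction N generalizing x with
  | zero => rfl
  | succ N ih => rw [pow_succ, pow_succ, Module.End.mul_apply, Module.End.mul_apply, ih,
      boundary_subdiv]

theorem homotopy_subdiv_pow_boundary (N : ℕ) (x : OrderedChain R P (k + 1)) :
    homotopy c k ((subdiv c k ^ N) (boundary x)) = (subdiv c (k + 1) ^ N) x -
      (subdiv c (k + 1) ^ (N + 1)) x -
      boundary (homotopy c (k + 1) ((subdiv c (k + 1) ^ N) x)) := by
  rw [← boundary_subdiv_pow, boundary_homotopy, pow_succ', Module.End.mul_apply, sub_sub_cancel]

variable {c} {c' : ∀ {k : ℕ}, (Fin (k + 1) → Q) → Q} {φ : P → Q}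

theorem map_subdiv (hφ : ∀ {k} (v : Fin (k + 1) → P), φ (c v) = c' (φ ∘ v))
    (x : OrderedChain R P k) : map R φ k (subdiv c k x) = subdiv c' k (map R φ k x) := by
  induction k with
  | zero => rfl
  | succ k ih =>
    refine LinearMap.congr_fun (f := map R φ (k + 1) ∘ₗ subdiv c (k + 1))
      (g := subdiv c' (k + 1) ∘ₗ map R φ (k + 1)) (hom_ext fun v => ?_) x
    rw [LinearMap.comp_apply, LinearMap.comp_apply, subdiv_single, map_cone, ih, map_boundary,
      map_single, subdiv_single, hφ]

theorem map_homotopy (hφ : ∀ {k} (v : Fin (k + 1) → P), φ (c v) = c' (φ ∘ v))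
    (x : OrderedChain R P k) :
    map R φ (k + 1) (homotopy c k x) = homotopy c' k (map R φ k x) := by
  induction k with
  | zero => exact map_zero _
  | succ k ih =>
    refine LinearMap.congr_fun (f := map R φ (k + 2) ∘ₗ homotopy c (k + 1))
      (g := homotopy c' (k + 1) ∘ₗ map R φ (k + 1)) (hom_ext fun v => ?_) x
    rw [LinearMap.comp_apply, LinearMap.comp_apply, homotopy_single, map_cone, map_sub, ih,
      map_boundary, map_single, homotopy_single, hφ]

theorem map_subdiv_pow (hφ : ∀ {k} (v : Fin (k + 1) → P), φ (c v) = c' (φ ∘ v)) (N : ℕ)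
    (x : OrderedChain R P k) :
    map R φ k ((subdiv c k ^ N) x) = (subdiv c' k ^ N) (map R φ k x) := by
  induction N generalizing x with
  | zero => rfl
  | succ N ih => rw [pow_succ, pow_succ, Module.End.mul_apply, Module.End.mul_apply, ih,
      map_subdiv hφ]

end Subdivision

section Support

theorem map_mem_of_mem_supported (f : OrderedChain R P k →ₗ[R] M) {s : Set (Fin k → P)}
    {W : Submodule R M} (hf : ∀ v ∈ s, f (Finsupp.single v 1) ∈ W) {x : OrderedChain R P k}
    (hx : x ∈ Finsupp.supported R R s) : f x ∈ W := by
  rw [Finsupp.supported_eq_span_single] at hx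
  exact Submodule.span_le (p := W.comap f).2 (Set.forall_mem_image.2 hf) hx

/-- The chains all of whose vertices lie in `s`. -/
def within (R : Type*) [Ring R] (k : ℕ) (s : Set P) : Submodule R (OrderedChain R P k) :=
  Finsupp.supported R R {v | ∀ i, v i ∈ s}

variable {s : Set P}

theorem single_mem_within {v : Fin k → P} (hv : ∀ i, v i ∈ s) :
    Finsupp.single v (1 : R) ∈ within R k s :=
  Finsupp.single_mem_supported R 1 hv

theorem boundary_mem_within {x : OrderedChain R P (k + 1)} (hx : x ∈ within R (k + 1) s) :
    boundary x ∈ within R k s := by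
  refine map_mem_of_mem_supported _ (fun v hv => ?_) hx
  rw [boundary_single]
  exact sum_mem fun i _ => Submodule.smul_mem _ _ (single_mem_within fun j => hv _)

theorem cone_mem_within {b : P} (hb : b ∈ s) {x : OrderedChain R P k} (hx : x ∈ within R k s) :
    cone b x ∈ within R (k + 1) s := by
  refine map_mem_of_mem_supported _ (fun v hv => ?_) hx
  rw [cone_single]
  exact single_mem_within fun i => Fin.cases hb hv i

variable {c : ∀ {k : ℕ}, (Fin (k + 1) → P) → P}

theorem subdiv_mem_within (hc : ∀ {k} (v : Fin (k + 1) → P), (∀ i, v i ∈ s) → c v ∈ s)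
    {x : OrderedChain R P k} (hx : x ∈ within R k s) : subdiv c k x ∈ within R k s := by
  induction k with
  | zero => exact hx
  | succ k ih =>
    refine map_mem_of_mem_supported _ (fun v hv => ?_) hx
    rw [subdiv_single]
    exact cone_mem_within (hc v hv) (ih (boundary_mem_within (single_mem_within hv)))

theorem homotopy_mem_within (hc : ∀ {k} (v : Fin (k + 1) → P), (∀ i, v i ∈ s) → c v ∈ s)
    {x : OrderedChain R P k} (hx : x ∈ within R k s) : homotopy c k x ∈ within R (k + 1) s := by
  induction k with
  | zero => exact zero_mem _
  | succ k ih =>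
    refine map_mem_of_mem_supported _ (fun v hv => ?_) hx
    rw [homotopy_single]
    exact cone_mem_within (hc v hv) (sub_mem (single_mem_within hv)
      (ih (boundary_mem_within (single_mem_within hv))))

end Support

end OrderedChain

section AffineSimplex

variable {ι κ l : Type*} [Fintype ι] [Fintype κ] [Fintype l]

/-- The affine map between standard simplices with prescribed values at the vertices. -/
noncomputable def affineSimplex (v : ι → stdSimplex ℝ κ) :
    C(stdSimplex ℝ ι, stdSimplex ℝ κ) where
  toFun x := ⟨∑ i, x i • (v i : κ → ℝ),
    (convex_stdSimplex ℝ κ).sum_mem (fun i _ => x.2.1 i) x.2.2 fun i _ => (v i).2⟩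
  continuous_toFun := .subtype_mk (continuous_finsetSum _ fun i _ => .fun_smul
    (f := fun x : stdSimplex ℝ ι => x i) ((continuous_apply i).comp continuous_subtype_val)
    continuous_const) _

namespace affineSimplex

theorem coe_apply (v : ι → stdSimplex ℝ κ) (x : stdSimplex ℝ ι) :
    (affineSimplex v x : κ → ℝ) = ∑ i, x i • (v i : κ → ℝ) := rfl

theorem apply_apply (v : ι → stdSimplex ℝ κ) (x : stdSimplex ℝ ι) (j : κ) :
    affineSimplex v x j = ∑ i, x i * v i j :=
  Finset.sum_apply j _ _

theorem apply_affineSimplex (w : κ → stdSimplex ℝ l) (v : ι → stdSimplex ℝ κ)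
    (x : stdSimplex ℝ ι) :
    affineSimplex w (affineSimplex v x) = affineSimplex (affineSimplex w ∘ v) x := by
  refine stdSimplex.ext (funext fun j => ?_)
  simp only [apply_apply, Finset.sum_mul, Finset.mul_sum, Function.comp_apply]
  rw [Finset.sum_comm]
  exact Finset.sum_congr rfl fun i _ => Finset.sum_congr rfl fun k _ => by ring

theorem comp_apply (v : κ → stdSimplex ℝ l) (θ : ι → κ) (x : stdSimplex ℝ ι) :
    affineSimplex (v ∘ θ) x = affineSimplex v (stdSimplex.map θ x) := by
  classical
  refine stdSimplex.ext (funext fun j => ?_)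
  simp only [apply_apply, stdSimplex.map_coe, FunOnFinite.linearMap_apply_apply, Finset.sum_mul,
    Function.comp_apply]
  rw [← Finset.sum_fiberwise Finset.univ θ]
  refine Finset.sum_congr rfl fun i _ => Finset.sum_congr rfl fun k hk => ?_
  rw [(Finset.mem_filter_univ k).1 hk]

theorem vertex_eq_id [DecidableEq ι] : affineSimplex (ι := ι) stdSimplex.vertex = .id _ :=
  ContinuousMap.ext fun x => stdSimplex.ext <| funext fun j => by
    simp [apply_apply, Pi.single_apply]

theorem comp_vertex [DecidableEq ι] (v : ι → stdSimplex ℝ κ) :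
    affineSimplex v ∘ stdSimplex.vertex = v :=
  funext fun i => stdSimplex.ext <| funext fun j => by simp [apply_apply, Pi.single_apply]

theorem apply_mem {C : Set (κ → ℝ)} (hC : Convex ℝ C) {v : ι → stdSimplex ℝ κ}
    (hv : ∀ i, (v i : κ → ℝ) ∈ C) (x : stdSimplex ℝ ι) : (affineSimplex v x : κ → ℝ) ∈ C :=
  hC.sum_mem (fun i _ => x.2.1 i) x.2.2 fun i _ => hv i

end affineSimplex

/-- The barycenter of a nonempty tuple of points, the apex of the cones in barycentric
subdivision. -/
noncomputable def barycenter {k : ℕ} (v : Fin (k + 1) → stdSimplex ℝ κ) : stdSimplex ℝ κ :=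
  affineSimplex v stdSimplex.barycenter

theorem affineSimplex_barycenter (w : κ → stdSimplex ℝ l) {k : ℕ}
    (v : Fin (k + 1) → stdSimplex ℝ κ) :
    affineSimplex w (barycenter v) = barycenter (affineSimplex w ∘ v) :=
  affineSimplex.apply_affineSimplex w v _

theorem dist_barycenter_le {m : ℕ} (v : Fin (m + 1) → stdSimplex ℝ κ) {D : ℝ}
    (hv : ∀ i j, dist (v i) (v j) ≤ D) (j : Fin (m + 1)) :
    dist (v j) (barycenter v) ≤ m / (m + 1) * D := by
  have hm : (0 : ℝ) < m + 1 := by positivity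
  have coe_barycenter : (barycenter v : κ → ℝ) = ((m : ℝ) + 1)⁻¹ • ∑ i, (v i : κ → ℝ) := by
    rw [barycenter, affineSimplex.coe_apply, Finset.smul_sum, ← Nat.cast_succ]
    refine Finset.sum_congr rfl fun i _ => congrArg (· • _) ?_
    exact (stdSimplex.barycenter_apply i).trans (by rw [Fintype.card_fin])
  have sub_barycenter : (v j : κ → ℝ) - barycenter v =
      ((m : ℝ) + 1)⁻¹ • ∑ i ∈ Finset.univ.erase j, ((v j : κ → ℝ) - v i) := by
    rw [Finset.sum_erase _ (sub_self _), Finset.sum_sub_distrib, smul_sub, coe_barycenter,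
      Finset.sum_const, Finset.card_univ, Fintype.card_fin, ← Nat.cast_smul_eq_nsmul ℝ, smul_smul,
      Nat.cast_succ, inv_mul_cancel₀ hm.ne', one_smul]
  calc dist (v j) (barycenter v) = ‖(v j : κ → ℝ) - barycenter v‖ :=
      dist_eq_norm (v j : κ → ℝ) (barycenter v)
    _ = (m + 1 : ℝ)⁻¹ * ‖∑ i ∈ Finset.univ.erase j, ((v j : κ → ℝ) - v i)‖ := by
      rw [sub_barycenter, norm_smul, norm_inv, Real.norm_of_nonneg hm.le]
    _ ≤ (m + 1 : ℝ)⁻¹ * ∑ _i ∈ Finset.univ.erase j, D := by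
      gcongr
      exact norm_sum_le_of_le _ fun i _ => (dist_eq_norm _ _).symm.trans_le (hv j i)
    _ = m / (m + 1) * D := by
      rw [Finset.sum_const, Finset.card_erase_of_mem (Finset.mem_univ j), Finset.card_univ,
        Fintype.card_fin, Nat.add_sub_cancel, nsmul_eq_mul]
      ring

end AffineSimplex

namespace OrderedChain

variable {R : Type*} [Ring R] {κ : Type*} [Fintype κ] {m : ℕ}

/-- The chains whose simplices have diameter at most `D`. -/
def diamLE (R P : Type*) [Ring R] [PseudoMetricSpace P] (k : ℕ) (D : ℝ) :
    Submodule R (OrderedChain R P k) :=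
  Finsupp.supported R R {v | ∀ i j, dist (v i) (v j) ≤ D}

section

variable {P : Type*} [PseudoMetricSpace P] {k : ℕ} {D : ℝ}

theorem single_mem_diamLE {v : Fin k → P} (hv : ∀ i j, dist (v i) (v j) ≤ D) :
    Finsupp.single v (1 : R) ∈ diamLE R P k D :=
  Finsupp.single_mem_supported R 1 hv

theorem boundary_mem_diamLE {x : OrderedChain R P (k + 1)} (hx : x ∈ diamLE R P (k + 1) D) :
    boundary x ∈ diamLE R P k D := by
  refine map_mem_of_mem_supported _ (fun v hv => ?_) hx
  rw [boundary_single]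
  exact sum_mem fun i _ => Submodule.smul_mem _ _ (single_mem_diamLE fun j l => hv _ _)

theorem diamLE_mono {E : ℝ} (hDE : D ≤ E) : diamLE R P k D ≤ diamLE R P k E :=
  Finsupp.supported_mono fun _ hv i j => (hv i j).trans hDE

theorem cone_mem_diamLE {b : P} (hD : 0 ≤ D) {x : OrderedChain R P k} (hx : x ∈ diamLE R P k D)
    (hb : x ∈ within R k (Metric.closedBall b D)) : cone b x ∈ diamLE R P (k + 1) D := by
  have h := Submodule.mem_inf.2 ⟨hx, hb⟩
  rw [within, diamLE, ← Finsupp.supported_inter] at h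
  refine map_mem_of_mem_supported _ (fun v hv => ?_) h
  rw [cone_single]
  refine single_mem_diamLE fun i j => ?_
  cases i using Fin.cases <;> cases j using Fin.cases
  · simpa using hD
  · simpa [dist_comm] using hv.2 _
  · simpa using hv.2 _
  · simpa using hv.1 _ _

end

theorem subdiv_mem_diamLE {D : ℝ} {x : OrderedChain R (stdSimplex ℝ κ) (m + 1)}
    (hx : x ∈ diamLE R _ (m + 1) D) :
    subdiv barycenter (m + 1) x ∈ diamLE R _ (m + 1) (m / (m + 1) * D) := by
  induction m with
  | zero =>
    exact (Finsupp.mem_supported R _).2 fun w _ i j => by simp [Subsingleton.elim (α := Fin 1) i j]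
  | succ m ih =>
    refine map_mem_of_mem_supported _ (fun v hv => ?_) hx
    rw [subdiv_single]
    have hD : 0 ≤ D := dist_nonneg.trans (hv 0 0)
    refine cone_mem_diamLE (by positivity) ?_ (subdiv_mem_within (fun w hw => ?_)
      (boundary_mem_within (single_mem_within fun i => dist_barycenter_le v hv i)))
    · refine diamLE_mono (mul_le_mul_of_nonneg_right ?_ hD)
        (ih (boundary_mem_diamLE (single_mem_diamLE hv)))
      rw [div_le_div_iff₀ (by positivity) (by positivity)]
      push_cast
      nlinarith
    · exact affineSimplex.apply_mem (convex_closedBall (barycenter v : κ → ℝ) _) hw _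

theorem subdiv_pow_mem_diamLE {D : ℝ} {x : OrderedChain R (stdSimplex ℝ κ) (m + 1)}
    (hx : x ∈ diamLE R _ (m + 1) D) (N : ℕ) :
    (subdiv barycenter (m + 1) ^ N) x ∈ diamLE R _ (m + 1) ((m / (m + 1)) ^ N * D) := by
  induction N with
  | zero => simpa using hx
  | succ N ih =>
    rw [pow_succ', mul_assoc, pow_succ', Module.End.mul_apply]
    exact subdiv_mem_diamLE ih

end OrderedChain

namespace SSetCochain

open Opposite OrderedChain Filter

variable {X : TopCat.{u}} {K : Type v} [Field K] {κ l : Type*} [Fintype κ] [Fintype l] {m n : ℕ}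

/-- The value of a cochain on the image under `σ` of an affine chain, where a tuple of points
stands for the affine simplex that they span. -/
noncomputable def pairing (a : SSetCochain (TopCat.toSSet.obj X) K m) (σ : C(stdSimplex ℝ κ, X)) :
    OrderedChain K (stdSimplex ℝ κ) (m + 1) →ₗ[K] K :=
  Finsupp.linearCombination K fun v =>
    a ((X.toSSetObjEquiv (op ⦋m⦌)).symm (σ.comp (affineSimplex v)))

theorem pairing_single (a : SSetCochain (TopCat.toSSet.obj X) K m) (σ : C(stdSimplex ℝ κ, X))
    (v : Fin (m + 1) → stdSimplex ℝ κ) : pairing a σ (Finsupp.single v 1) =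
      a ((X.toSSetObjEquiv (op ⦋m⦌)).symm (σ.comp (affineSimplex v))) := by
  rw [pairing, Finsupp.linearCombination_single, one_smul]

theorem pairing_zero (σ : C(stdSimplex ℝ κ, X)) :
    pairing (0 : SSetCochain (TopCat.toSSet.obj X) K m) σ = 0 :=
  OrderedChain.hom_ext fun v => pairing_single 0 σ v

theorem pairing_boundary (a : SSetCochain (TopCat.toSSet.obj X) K m) (σ : C(stdSimplex ℝ κ, X))
    (x : OrderedChain K (stdSimplex ℝ κ) (m + 2)) :
    pairing a σ (boundary x) = pairing (coboundary m a) σ x := by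
  refine LinearMap.congr_fun (f := pairing a σ ∘ₗ boundary) (OrderedChain.hom_ext fun v => ?_) x
  rw [LinearMap.comp_apply, boundary_single, pairing_single, coboundary_apply, map_sum]
  refine Finset.sum_congr rfl fun i _ => ?_
  rw [map_smul, pairing_single, smul_eq_mul, TopCat.toSSetObjEquiv_symm_naturality]
  congr 3
  ext x : 1
  exact congrArg σ (affineSimplex.comp_apply v _ x)

theorem pairing_comp_affineSimplex (a : SSetCochain (TopCat.toSSet.obj X) K m)
    (σ : C(stdSimplex ℝ κ, X)) (w : l → stdSimplex ℝ κ)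
    (x : OrderedChain K (stdSimplex ℝ l) (m + 1)) :
    pairing a (σ.comp (affineSimplex w)) x = pairing a σ (map K (affineSimplex w) (m + 1) x) := by
  refine LinearMap.congr_fun (g := pairing a σ ∘ₗ map K _ _) (OrderedChain.hom_ext fun v => ?_) x
  rw [LinearMap.comp_apply, map_single, pairing_single, pairing_single]
  congr 2
  ext x : 1
  exact congrArg σ (affineSimplex.apply_affineSimplex w v x)

/-- The affine chain given by the standard simplex itself. -/
noncomputable def tautologicalChain (K : Type*) [Ring K] (n : ℕ) :
    OrderedChain K (stdSimplex ℝ (Fin n)) n :=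
  Finsupp.single stdSimplex.vertex 1

theorem tautologicalChain_mem_diamLE : tautologicalChain K n ∈ diamLE K _ n 1 :=
  single_mem_diamLE fun i j => (dist_pi_le_iff zero_le_one).2 fun l =>
    Real.dist_le_of_mem_Icc_01 (mem_Icc_of_mem_stdSimplex (stdSimplex.vertex i).2 l)
      (mem_Icc_of_mem_stdSimplex (stdSimplex.vertex j).2 l)

/-- The pullback of a cochain along the `N`-fold barycentric subdivision. -/
noncomputable def subdivision (N : ℕ) (a : SSetCochain (TopCat.toSSet.obj X) K n) :
    SSetCochain (TopCat.toSSet.obj X) K n := fun s =>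
  pairing a (X.toSSetObjEquiv (op ⦋n⦌) s)
    ((subdiv barycenter (n + 1) ^ N) (tautologicalChain K (n + 1)))

/-- The cochain homotopy between `subdivision N` and `subdivision (N + 1)`. -/
noncomputable def subdivisionHomotopy (N : ℕ) (a : SSetCochain (TopCat.toSSet.obj X) K (n + 1)) :
    SSetCochain (TopCat.toSSet.obj X) K n := fun s =>
  pairing a (X.toSSetObjEquiv (op ⦋n⦌) s)
    (homotopy barycenter (n + 1) ((subdiv barycenter (n + 1) ^ N) (tautologicalChain K (n + 1))))

theorem subdivision_zero (a : SSetCochain (TopCat.toSSet.obj X) K n) : subdivision 0 a = a := by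
  funext s
  rw [subdivision, pow_zero, Module.End.one_apply, tautologicalChain, pairing_single,
    affineSimplex.vertex_eq_id, ContinuousMap.comp_id, Equiv.symm_apply_apply]

theorem pairing_comp_homotopy_subdiv_pow (N : ℕ) (a : SSetCochain (TopCat.toSSet.obj X) K (n + 1))
    (σ : C(stdSimplex ℝ κ, X)) (w : Fin (n + 1) → stdSimplex ℝ κ) :
    pairing a (σ.comp (affineSimplex w)) (homotopy barycenter (n + 1)
      ((subdiv barycenter (n + 1) ^ N) (tautologicalChain K (n + 1)))) =
    pairing a σ (homotopy barycenter (n + 1)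
      ((subdiv barycenter (n + 1) ^ N) (Finsupp.single w 1))) := by
  rw [pairing_comp_affineSimplex, map_homotopy (affineSimplex_barycenter w),
    map_subdiv_pow (affineSimplex_barycenter w), tautologicalChain, map_single,
    affineSimplex.comp_vertex]

theorem subdivisionHomotopy_map_δ (N : ℕ) (a : SSetCochain (TopCat.toSSet.obj X) K (n + 1))
    (s : TopCat.toSSet.obj X _⦋n + 1⦌) (i : Fin (n + 2)) :
    subdivisionHomotopy N a ((TopCat.toSSet.obj X).map (SimplexCategory.δ i).op s) =
      pairing a (X.toSSetObjEquiv (op ⦋n + 1⦌) s)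
        (homotopy barycenter (n + 1) ((subdiv barycenter (n + 1) ^ N)
          (Finsupp.single (stdSimplex.vertex ∘ i.succAbove) 1))) := by
  have face_eq :
      X.toSSetObjEquiv (op ⦋n⦌) ((TopCat.toSSet.obj X).map (SimplexCategory.δ i).op s) =
      (X.toSSetObjEquiv (op ⦋n + 1⦌) s).comp (affineSimplex (stdSimplex.vertex ∘ i.succAbove)) := by
    ext x : 1
    rw [ContinuousMap.comp_apply, affineSimplex.comp_apply, affineSimplex.vertex_eq_id]
    rfl
  rw [subdivisionHomotopy, face_eq]
  exact pairing_comp_homotopy_subdiv_pow N a _ _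

theorem coboundary_subdivisionHomotopy (N : ℕ) {a : SSetCochain (TopCat.toSSet.obj X) K (n + 1)}
    (ha : coboundary (n + 1) a = 0) :
    coboundary n (subdivisionHomotopy N a) = subdivision N a - subdivision (N + 1) a := by
  funext s
  calc coboundary n (subdivisionHomotopy N a) s
      = pairing a (X.toSSetObjEquiv (op ⦋n + 1⦌) s) (homotopy barycenter (n + 1)
          ((subdiv barycenter (n + 1) ^ N) (boundary (tautologicalChain K (n + 2))))) := by
        simp only [coboundary_apply, subdivisionHomotopy_map_δ, tautologicalChain, boundary_single,
          map_sum, map_smul, smul_eq_mul]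
    _ = subdivision N a s - subdivision (N + 1) a s := by
        rw [homotopy_subdiv_pow_boundary, map_sub, map_sub, pairing_boundary, ha, pairing_zero,
          LinearMap.zero_apply, sub_zero]
        rfl

theorem coboundary_sum_subdivisionHomotopy (N : ℕ)
    {a : SSetCochain (TopCat.toSSet.obj X) K (n + 1)} (ha : coboundary (n + 1) a = 0) :
    coboundary n (∑ k ∈ Finset.range N, subdivisionHomotopy k a) = a - subdivision N a := by
  rw [map_sum, Finset.sum_congr rfl fun k _ => coboundary_subdivisionHomotopy k ha,
    Finset.sum_range_sub', subdivision_zero]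

section Small

variable {ι : Type*} {U : ι → Set X} {σ : C(stdSimplex ℝ κ, X)}

/-- The affine chains each of whose simplices is mapped by `σ` into one of the sets `U i`. -/
def smallChains (K : Type*) [Ring K] (U : ι → Set X) (σ : C(stdSimplex ℝ κ, X)) (m : ℕ) :
    Submodule K (OrderedChain K (stdSimplex ℝ κ) m) :=
  Finsupp.supported K K {v | ∃ i, ∀ x, σ (affineSimplex v x) ∈ U i}

theorem mem_smallChains_of_forall_mem {i : ι} (hσ : ∀ y, σ y ∈ U i)
    (x : OrderedChain K (stdSimplex ℝ κ) m) : x ∈ smallChains K U σ m :=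
  (Finsupp.mem_supported K x).2 fun _ _ => ⟨i, fun _ => hσ _⟩

theorem homotopy_mem_smallChains {x : OrderedChain K (stdSimplex ℝ κ) m}
    (hx : x ∈ smallChains K U σ m) : homotopy barycenter m x ∈ smallChains K U σ (m + 1) := by
  refine map_mem_of_mem_supported _ (fun v hv => ?_) hx
  obtain ⟨i, hi⟩ := hv
  have vertex_mem (j : Fin m) : v j ∈ Set.range (affineSimplex v) :=
    ⟨stdSimplex.vertex j, congrFun (affineSimplex.comp_vertex v) j⟩
  have barycenter_mem {k : ℕ} (w : Fin (k + 1) → stdSimplex ℝ κ)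
      (hw : ∀ j, w j ∈ Set.range (affineSimplex v)) :
      barycenter w ∈ Set.range (affineSimplex v) := by
    choose y hy using hw
    exact ⟨barycenter y, (affineSimplex_barycenter v y).trans (congrArg _ (funext hy))⟩
  have within_le : within K (m + 1) (Set.range (affineSimplex v)) ≤ smallChains K U σ (m + 1) := by
    refine Finsupp.supported_mono fun w hw => ?_
    choose y hy using hw
    refine ⟨i, fun x => ?_⟩
    rw [← funext hy]
    exact affineSimplex.apply_affineSimplex v y x ▸ hi _
  exact within_le (homotopy_mem_within barycenter_mem (single_mem_within vertex_mem))

theorem pairing_eq_zero_of_mem_smallChains {a : SSetCochain (TopCat.toSSet.obj X) K m}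
    (ha : ∀ i, ∀ τ : C(stdSimplex ℝ (Fin (m + 1)), X), (∀ x, τ x ∈ U i) →
      a ((X.toSSetObjEquiv (op ⦋m⦌)).symm τ) = 0)
    {x : OrderedChain K (stdSimplex ℝ κ) (m + 1)} (hx : x ∈ smallChains K U σ (m + 1)) :
    pairing a σ x = 0 := by
  rw [← Submodule.mem_bot K]
  refine map_mem_of_mem_supported _ (fun v hv => ?_) hx
  obtain ⟨i, hi⟩ := hv
  rw [pairing_single, Submodule.mem_bot]
  exact ha i _ hi

theorem eventually_subdiv_pow_mem_smallChains (hU : ∀ i, IsOpen (U i))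
    (hcover : ⋃ i, U i = .univ) (σ : C(stdSimplex ℝ κ, X)) {D : ℝ}
    {x : OrderedChain K (stdSimplex ℝ κ) (n + 1)}
    (hx : x ∈ diamLE K _ (n + 1) D) :
    ∀ᶠ N in atTop, (subdiv barycenter (n + 1) ^ N) x ∈ smallChains K U σ (n + 1) := by
  obtain ⟨δ, hδ, hball⟩ := lebesgue_number_lemma_of_metric (c := fun i => σ ⁻¹' U i)
    isCompact_univ (fun i => (hU i).preimage σ.continuous)
    (by rw [← Set.preimage_iUnion, hcover, Set.preimage_univ])
  have mesh_tendsto : Tendsto (fun N => ((n : ℝ) / (n + 1)) ^ N * D) atTop (nhds 0) := by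
    simpa using (tendsto_pow_atTop_nhds_zero_of_lt_one (by positivity)
      (div_lt_one (by positivity) |>.2 (lt_add_one (n : ℝ)))).mul_const D
  filter_upwards [mesh_tendsto.eventually_lt_const hδ] with N hN
  refine Finsupp.supported_mono (fun v hv => ?_) (subdiv_pow_mem_diamLE hx N)
  obtain ⟨i, hi⟩ := hball (v 0) trivial
  exact ⟨i, fun x => hi (affineSimplex.apply_mem (convex_ball (v 0 : κ → ℝ) δ)
    (fun j => (hv j 0).trans_lt hN) x)⟩

/-- The inclusion of a subset of a topological space. -/
def subspaceInclusion (V : Set X) : TopCat.of V ⟶ X :=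
  TopCat.ofHom ⟨Subtype.val, continuous_subtype_val⟩

theorem pullback_subspaceInclusion_eq_zero_iff {V : Set X}
    {a : SSetCochain (TopCat.toSSet.obj X) K n} :
    pullback (TopCat.toSSet.map (subspaceInclusion V)) n a = 0 ↔
      ∀ τ : C(stdSimplex ℝ (Fin (n + 1)), X), (∀ x, τ x ∈ V) →
        a ((X.toSSetObjEquiv (op ⦋n⦌)).symm τ) = 0 := by
  refine ⟨fun h τ hτ => ?_, fun h => funext fun s => ?_⟩
  · exact congrFun h (((TopCat.of V).toSSetObjEquiv (op ⦋n⦌)).symm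
      ⟨fun x => ⟨τ x, hτ x⟩, τ.continuous.subtype_mk hτ⟩)
  · exact h ⟨_, continuous_subtype_val.comp ((TopCat.of V).toSSetObjEquiv (op ⦋n⦌) s).continuous⟩
      fun x => ((TopCat.of V).toSSetObjEquiv (op ⦋n⦌) s x).2

theorem exists_coboundary_eq_of_pullback_eq_zero (hU : ∀ i, IsOpen (U i))
    (hcover : ⋃ i, U i = .univ) {a : SSetCochain (TopCat.toSSet.obj X) K (n + 1)}
    (ha : coboundary (n + 1) a = 0)
    (haU : ∀ i, pullback (TopCat.toSSet.map (subspaceInclusion (U i))) (n + 1) a = 0) :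
    ∃ b, coboundary n b = a ∧
      ∀ i, pullback (TopCat.toSSet.map (subspaceInclusion (U i))) n b = 0 := by
  simp only [pullback_subspaceInclusion_eq_zero_iff] at haU ⊢
  have eventually_small (k : ℕ) (s : TopCat.toSSet.obj X _⦋k⦌) :=
    eventually_subdiv_pow_mem_smallChains hU hcover (X.toSSetObjEquiv (op ⦋k⦌) s)
      (tautologicalChain_mem_diamLE (K := K) (n := k + 1))
  -- The primitive is the infinite sum of the subdivision homotopies of `a`: on each simplex all but
  -- finitely many terms vanish, because iterated subdivision makes the simplices small.
  let partialSum (N : ℕ) := ∑ k ∈ Finset.range N, subdivisionHomotopy k a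
  have eventually_const (s : TopCat.toSSet.obj X _⦋n⦌) :
      ∃ b, ∀ᶠ N in atTop, partialSum N s = b := by
    obtain ⟨M, hM⟩ := eventually_atTop.1 (eventually_small n s)
    refine ⟨partialSum M s, eventually_atTop.2 ⟨M, fun N hN => ?_⟩⟩
    simp only [partialSum, Finset.sum_apply]
    exact (Finset.sum_subset (Finset.range_mono hN) fun k _ hk =>
      pairing_eq_zero_of_mem_smallChains haU
        (homotopy_mem_smallChains (hM k (by simpa using hk)))).symm
  choose b hb using eventually_const
  refine ⟨b, funext fun s => ?_, fun i τ hτ => ?_⟩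
  · obtain ⟨N, hfaces, hsmall⟩ := ((eventually_all.2 fun i : Fin (n + 2) =>
      hb ((TopCat.toSSet.obj X).map (SimplexCategory.δ i).op s)).and
        (eventually_small (n + 1) s)).exists
    have partial_eq := congrFun (coboundary_sum_subdivisionHomotopy N ha) s
    rw [Pi.sub_apply, subdivision, pairing_eq_zero_of_mem_smallChains haU hsmall, sub_zero]
      at partial_eq
    rw [← partial_eq, coboundary_apply, coboundary_apply]
    exact Finset.sum_congr rfl fun i _ => by rw [← hfaces i]
  · obtain ⟨N, hN⟩ := (hb ((X.toSSetObjEquiv (op ⦋n⦌)).symm τ)).exists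
    rw [← hN]
    simp only [partialSum, Finset.sum_apply]
    exact Finset.sum_eq_zero fun k _ => pairing_eq_zero_of_mem_smallChains haU
      (mem_smallChains_of_forall_mem (fun x => (Equiv.apply_symm_apply _ τ).symm ▸ hτ x) _)

end Small

end SSetCochain

theorem exists_directSum_forall_apply {ι : Type*} {β : ι → Type*} [∀ n, AddCommMonoid (β n)]
    {P : ∀ n, β n → Prop} (h : ∀ n, ∃ x, P n x) (hfin : {n | ¬ P n 0}.Finite) :
    ∃ x : ⨁ n, β n, ∀ n, P n (x n) := by
  classical
  choose x hx using h
  refine ⟨mk β hfin.toFinset fun n => x n, fun n => ?_⟩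
  by_cases hn : n ∈ hfin.toFinset
  · rw [mk_apply_of_mem hn]
    exact hx n
  · rw [mk_apply_of_notMem hn]
    exact not_not.1 fun h => hn (hfin.mem_toFinset.2 h)

namespace SSetCochain

open Opposite

section

variable {S T : SSet.{u}} {K : Type v} [Field K]

theorem pullbackAlgHom_apply (φ : S ⟶ T) (x : ⨁ n, SSetCochain T K n) (n : ℕ) :
    pullbackAlgHom φ K x n = pullback φ n (x n) := by
  induction x using DirectSum.induction_on with
  | zero => simp only [map_zero, DirectSum.zero_apply]
  | of m f =>
    rw [pullbackAlgHom_of]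
    obtain rfl | hnm := eq_or_ne n m
    · rw [of_eq_same, of_eq_same]
    · rw [of_eq_of_ne _ _ _ hnm, of_eq_of_ne _ _ _ hnm, map_zero]
  | add x y hx hy => rw [map_add, DirectSum.add_apply, hx, hy, DirectSum.add_apply, map_add]

theorem totalCoboundary_apply_zero (x : ⨁ n, SSetCochain S K n) :
    totalCoboundary S K x 0 = 0 := by
  induction x using DirectSum.induction_on with
  | zero => simp only [map_zero, DirectSum.zero_apply]
  | of m f => rw [totalCoboundary_of, of_eq_of_ne _ _ _ m.succ_ne_zero.symm]
  | add x y hx hy => rw [map_add, DirectSum.add_apply, hx, hy, add_zero]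

theorem totalCoboundary_apply_succ (x : ⨁ n, SSetCochain S K n) (n : ℕ) :
    totalCoboundary S K x (n + 1) = coboundary n (x n) := by
  induction x using DirectSum.induction_on with
  | zero => simp only [map_zero, DirectSum.zero_apply]
  | of m f =>
    rw [totalCoboundary_of]
    obtain rfl | hnm := eq_or_ne n m
    · rw [of_eq_same, of_eq_same]
    · rw [of_eq_of_ne _ _ _ hnm, of_eq_of_ne _ _ _ (by simpa using hnm), map_zero]
  | add x y hx hy => rw [map_add, DirectSum.add_apply, hx, hy, DirectSum.add_apply, map_add]

theorem coboundary_eq_zero_of_totalCoboundary_of_eq_zero {n : ℕ} {f : SSetCochain S K n}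
    (hf : totalCoboundary S K (of _ n f) = 0) : coboundary n f = 0 := by
  rw [totalCoboundary_of] at hf
  exact of_injective _ (hf.trans (map_zero _).symm)

theorem pullbackAlgHom_surjective {φ : S ⟶ T} (hφ : ∀ n, Function.Injective (φ.app (op ⦋n⦌))) :
    Function.Surjective (pullbackAlgHom φ K) := fun x => by
  obtain ⟨y, hy⟩ := exists_directSum_forall_apply (P := fun n f => pullback φ n f = x n)
    (fun n => LinearMap.funLeft_surjective_of_injective K K _ (hφ n) (x n))
    ((DFinsupp.finite_support x).subset fun n hn h => hn (by rw [map_zero, h]))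
  exact ⟨y, DirectSum.ext fun n => (pullbackAlgHom_apply φ y n).trans (hy n)⟩

end

section Square

variable {S A B D : SSet.{u}} {K : Type v} [Field K] {i : A ⟶ S} {j : B ⟶ S} {k : D ⟶ A}
  {l : D ⟶ B}

theorem exists_pullback_eq_pullback_eq {n : ℕ} (hi : Function.Injective (i.app (op ⦋n⦌)))
    (hj : Function.Injective (j.app (op ⦋n⦌)))
    (hij : ∀ a b, i.app (op ⦋n⦌) a = j.app (op ⦋n⦌) b →
      ∃ d, k.app (op ⦋n⦌) d = a ∧ l.app (op ⦋n⦌) d = b)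
    {f : SSetCochain A K n} {g : SSetCochain B K n} (hfg : pullback k n f = pullback l n g) :
    ∃ h, pullback i n h = f ∧ pullback j n h = g := by
  classical
  refine ⟨Function.extend (i.app _) f (Function.extend (j.app _) g 0),
    funext fun a => hi.extend_apply _ _ a, funext fun b => ?_⟩
  rw [pullback_apply]
  by_cases hb : ∃ a, i.app _ a = j.app _ b
  · obtain ⟨a, ha⟩ := hb
    obtain ⟨d, rfl, rfl⟩ := hij a b ha
    rw [← ha, hi.extend_apply]
    exact congrFun hfg d
  · rw [Function.extend_apply' _ _ _ hb, hj.extend_apply]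

theorem exists_pullbackAlgHom_eq_pullbackAlgHom_eq
    (hi : ∀ n, Function.Injective (i.app (op ⦋n⦌))) (hj : ∀ n, Function.Injective (j.app (op ⦋n⦌)))
    (hij : ∀ n a b, i.app (op ⦋n⦌) a = j.app (op ⦋n⦌) b →
      ∃ d, k.app (op ⦋n⦌) d = a ∧ l.app (op ⦋n⦌) d = b)
    {x : ⨁ n, SSetCochain A K n} {y : ⨁ n, SSetCochain B K n}
    (hxy : pullbackAlgHom k K x = pullbackAlgHom l K y) :
    ∃ z, pullbackAlgHom i K z = x ∧ pullbackAlgHom j K z = y := by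
  obtain ⟨z, hz⟩ := exists_directSum_forall_apply
    (P := fun n h => pullback i n h = x n ∧ pullback j n h = y n)
    (fun n => exists_pullback_eq_pullback_eq (hi n) (hj n) (hij n)
      (by rw [← pullbackAlgHom_apply, hxy, pullbackAlgHom_apply]))
    (((DFinsupp.finite_support x).union (DFinsupp.finite_support y)).subset fun n hn => by
      simpa [eq_comm, imp_iff_not_or] using hn)
  exact ⟨z, DirectSum.ext fun n => (pullbackAlgHom_apply i z n).trans (hz n).1,
    DirectSum.ext fun n => (pullbackAlgHom_apply j z n).trans (hz n).2⟩

end Square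

section Restriction

variable {X W : TopCat.{u}} {K : Type v} [Field K] {ι : Type*} {U : ι → Set X}

theorem toSSet_map_app_injective {φ : W ⟶ X} (hφ : Function.Injective φ) (n : ℕ) :
    Function.Injective ((TopCat.toSSet.map φ).app (op ⦋n⦌)) := by
  have : Mono φ := (TopCat.mono_iff_injective φ).2 hφ
  exact (mono_iff_injective _).1 inferInstance

variable (K) in
/-- The restriction of singular cochains to a subspace. -/
noncomputable def restriction (V : Set X) :
    DGAlgebra.Hom (cochainAlgebra (TopCat.toSSet.obj X) K)
      (cochainAlgebra (TopCat.toSSet.obj (TopCat.of V)) K) :=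
  pullbackHom (TopCat.toSSet.map (subspaceInclusion V)) K

theorem exists_totalCoboundary_eq_of_restriction_eq_zero (hU : ∀ i, IsOpen (U i))
    (hcover : ⋃ i, U i = .univ) {x : ⨁ n, SSetCochain (TopCat.toSSet.obj X) K n}
    (hx : totalCoboundary _ K x = 0) (hxU : ∀ i, (restriction K (U i)).toAlgHom x = 0) :
    ∃ y, totalCoboundary _ K y = x ∧ ∀ i, (restriction K (U i)).toAlgHom y = 0 := by
  have pullback_eq_zero (n : ℕ) (i : ι) :
      pullback (TopCat.toSSet.map (subspaceInclusion (U i))) n (x n) = 0 := by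
    rw [← pullbackAlgHom_apply]
    exact DFunLike.congr_fun (F := ⨁ n, SSetCochain _ K n) (hxU i) n
  have apply_zero : x 0 = 0 := funext fun s => by
    obtain ⟨i, hi⟩ := Set.mem_iUnion.1 (hcover ▸ Set.mem_univ (X.toSSetObjEquiv _ s default))
    exact pullback_subspaceInclusion_eq_zero_iff.1 (pullback_eq_zero 0 i) (X.toSSetObjEquiv _ s)
      fun y => Subsingleton.elim default y ▸ hi
  obtain ⟨y, hy⟩ := exists_directSum_forall_apply
    (P := fun n b => coboundary n b = x (n + 1) ∧
      ∀ i, pullback (TopCat.toSSet.map (subspaceInclusion (U i))) n b = 0)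
    (fun n => exists_coboundary_eq_of_pullback_eq_zero hU hcover
      (by rw [← totalCoboundary_apply_succ, hx, DirectSum.zero_apply]) (pullback_eq_zero (n + 1)))
    (((DFinsupp.finite_support x).preimage (add_left_injective 1).injOn).subset fun n hn h => hn
      ⟨by rw [map_zero, h], fun i => map_zero _⟩)
  refine ⟨y, DirectSum.ext fun n => ?_,
    fun i => DirectSum.ext fun n => (pullbackAlgHom_apply _ y n).trans ((hy n).2 i)⟩
  cases n with
  | zero => rw [totalCoboundary_apply_zero, apply_zero]
  | succ n => rw [totalCoboundary_apply_succ, (hy n).1]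

end Restriction

end SSetCochain

/-! ### Mayer–Vietoris -/

namespace SSetCochain

open Opposite

section MayerVietoris

open DGAlgebra

variable {X : TopCat.{u}} {K : Type v} [Field K] {U V : Set X}

/-- The inclusion of a subspace into a larger one. -/
def subspaceInclusionOfSubset (hUV : U ⊆ V) : TopCat.of U ⟶ TopCat.of V :=
  TopCat.ofHom (ContinuousMap.inclusion hUV)

variable (K) in
/-- The restriction of singular cochains from a subspace to a smaller one. -/
noncomputable def restrictionOfSubset (hUV : U ⊆ V) :
    DGAlgebra.Hom (cochainAlgebra (TopCat.toSSet.obj (TopCat.of V)) K)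
      (cochainAlgebra (TopCat.toSSet.obj (TopCat.of U)) K) :=
  pullbackHom (TopCat.toSSet.map (subspaceInclusionOfSubset hUV)) K

theorem restrictionOfSubset_restriction (hUV : U ⊆ V)
    (x : (cochainAlgebra (TopCat.toSSet.obj X) K).carrier) :
    (restrictionOfSubset K hUV).toAlgHom ((restriction K V).toAlgHom x) =
      (restriction K U).toAlgHom x :=
  DirectSum.ext fun n => by
    refine (pullbackAlgHom_apply _ _ n).trans ?_
    refine (congrArg _ (pullbackAlgHom_apply _ x n)).trans ?_
    exact (pullbackAlgHom_apply (TopCat.toSSet.map (subspaceInclusion U)) x n).symm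

theorem restrictionOfSubset_surjective (hUV : U ⊆ V) :
    Function.Surjective (restrictionOfSubset K hUV).toAlgHom :=
  pullbackAlgHom_surjective (toSSet_map_app_injective (Set.inclusion_injective hUV))

theorem exists_restriction_eq_restriction_eq
    {x : (cochainAlgebra (TopCat.toSSet.obj (TopCat.of U)) K).carrier}
    {y : (cochainAlgebra (TopCat.toSSet.obj (TopCat.of V)) K).carrier}
    (hxy : (restrictionOfSubset K (U.inter_subset_left (t := V))).toAlgHom x =
      (restrictionOfSubset K U.inter_subset_right).toAlgHom y) :
    ∃ z, (restriction K U).toAlgHom z = x ∧ (restriction K V).toAlgHom z = y := by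
  refine exists_pullbackAlgHom_eq_pullbackAlgHom_eq
    (toSSet_map_app_injective Subtype.val_injective)
    (toSSet_map_app_injective Subtype.val_injective) (fun n a b hab => ?_) hxy
  let σ := (TopCat.of U).toSSetObjEquiv (op ⦋n⦌) a
  let τ := (TopCat.of V).toSSetObjEquiv (op ⦋n⦌) b
  have coe_eq (p) : (σ p : X) = τ p :=
    DFunLike.congr_fun (congrArg (X.toSSetObjEquiv (op ⦋n⦌)) hab) p
  refine ⟨((TopCat.of (U ∩ V : Set X)).toSSetObjEquiv (op ⦋n⦌)).symm
    ⟨fun p => ⟨σ p, (σ p).2, coe_eq p ▸ (τ p).2⟩,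
      (continuous_subtype_val.comp σ.continuous).subtype_mk _⟩, rfl, ?_⟩
  exact ((TopCat.of V).toSSetObjEquiv (op ⦋n⦌)).injective
    (ContinuousMap.ext fun p => Subtype.ext (coe_eq p))

variable (K U V) in
/-- The homotopy pullback of the restrictions `C(U) → C(U ∩ V) ← C(V)`. -/
noncomputable abbrev mayerVietoris : DGAlgebra.{v, max u v} K :=
  homotopyPullback (restrictionOfSubset K (U.inter_subset_left (t := V)))
    (restrictionOfSubset K (U.inter_subset_right (t := V)))

variable (K U V) in
/-- The morphism `x ↦ ((x|U, x|V), 0)`. -/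
noncomputable def toMayerVietoris :
    Hom (cochainAlgebra (TopCat.toSSet.obj X) K) (mayerVietoris K U V) :=
  HomotopyPullback.lift (restriction K U) (restriction K V) fun x => by
    rw [restrictionOfSubset_restriction, restrictionOfSubset_restriction]

theorem toMayerVietoris_isQuasiIso (hU : IsOpen U) (hV : IsOpen V) (hUV : U ∪ V = .univ) :
    (toMayerVietoris K U V).IsQuasiIso := by
  refine HomotopyPullback.lift_isQuasiIso (restrictionOfSubset_surjective _)
    (fun _ _ => exists_restriction_eq_restriction_eq) fun x hxU hxV hx => ?_
  rw [Set.union_eq_iUnion] at hUV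
  obtain ⟨y, hy, hyUV⟩ := exists_totalCoboundary_eq_of_restriction_eq_zero
    (Bool.forall_bool.2 ⟨hV, hU⟩) hUV hx (Bool.forall_bool.2 ⟨hxV, hxU⟩)
  exact ⟨y, hyUV true, hyUV false, hy⟩

theorem toMayerVietoris_toAlgHom (x : (cochainAlgebra (TopCat.toSSet.obj X) K).carrier) :
    (toMayerVietoris K U V).toAlgHom x =
      HomotopyPullback.mk ((restriction K U).toAlgHom x) ((restriction K V).toAlgHom x) 0 := rfl

variable {z : (cochainAlgebra (TopCat.toSSet.obj X) K).carrier}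

theorem exists_d_eq_restriction (hU : (subspaceInclusion U).hom.Nullhomotopic) {n : ℕ}
    (hz : z ∈ (cochainAlgebra _ K).deg (n + 1 : ℕ)) (hdz : (cochainAlgebra _ K).d z = 0) :
    ∃ u ∈ (cochainAlgebra (TopCat.toSSet.obj (TopCat.of U)) K).deg n,
      (cochainAlgebra _ K).d u = (restriction K U).toAlgHom z := by
  obtain ⟨f, rfl⟩ := hz
  obtain ⟨u, hu⟩ := exists_coboundary_eq_pullback_of_nullhomotopic hU n f
    (coboundary_eq_zero_of_totalCoboundary_of_eq_zero hdz)
  refine ⟨of _ n u, of_mem_degree n u, (totalCoboundary_of n u).trans ?_⟩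
  rw [hu]
  exact (pullbackAlgHom_of _ f).symm

theorem exists_restriction_eq_algebraMap (hU : (subspaceInclusion U).hom.Nullhomotopic)
    (hz : z ∈ (cochainAlgebra _ K).deg 0) (hdz : (cochainAlgebra _ K).d z = 0) :
    ∃ c, (restriction K U).toAlgHom z = algebraMap K _ c := by
  obtain ⟨f, rfl⟩ := hz
  obtain ⟨c, hc⟩ := exists_pullback_eq_const_of_nullhomotopic hU f
    (coboundary_eq_zero_of_totalCoboundary_of_eq_zero hdz)
  refine ⟨c, (pullbackAlgHom_of _ f).trans ?_⟩
  rw [hc]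
  rfl

theorem exists_d_eq_toMayerVietoris_sub_link (hU : (subspaceInclusion U).hom.Nullhomotopic)
    (hV : (subspaceInclusion V).hom.Nullhomotopic) {n : ℕ}
    (hz : z ∈ (cochainAlgebra _ K).deg (n + 1 : ℕ)) (hdz : (cochainAlgebra _ K).d z = 0) :
    ∃ l ∈ (mayerVietoris K U V).deg (n + 1 : ℕ), l ∈ HomotopyPullback.links _ _ ∧
      ∃ y, (mayerVietoris K U V).d y = (toMayerVietoris K U V).toAlgHom z - l := by
  obtain ⟨u, hu, hdu⟩ := exists_d_eq_restriction hU hz hdz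
  obtain ⟨v, hv, hdv⟩ := exists_d_eq_restriction hV hz hdz
  let m := (restrictionOfSubset K U.inter_subset_right).toAlgHom v -
    (restrictionOfSubset K (U.inter_subset_left (t := V))).toAlgHom u
  have hm : m ∈ (cochainAlgebra _ K).deg ((n + 1 : ℕ) - 1 : ℤ) := by
    rw [Nat.cast_succ, add_sub_cancel_right]
    exact sub_mem (Hom.map_deg _ hv) (Hom.map_deg _ hu)
  refine ⟨HomotopyPullback.mk 0 0 m,
    HomotopyPullback.mem_grading.2 ⟨zero_mem _, zero_mem _, hm⟩, rfl,
    HomotopyPullback.mk u v 0, ?_⟩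
  rw [HomotopyPullback.homotopyPullback_d, hdu, hdv, toMayerVietoris_toAlgHom]
  refine HomotopyPullback.ext (sub_zero _).symm (sub_zero _).symm ?_
  change _ - _ - _ = (0 : (cochainAlgebra _ K).carrier) - (_ - _)
  rw [map_zero, sub_zero, zero_sub, neg_sub]

theorem nontrivial_cochainAlgebra {S : SSet.{u}} [Nonempty (S _⦋0⦌)] :
    Nontrivial (cochainAlgebra S K).carrier := by
  obtain ⟨s⟩ := ‹Nonempty (S _⦋0⦌)›
  refine ⟨1, 0, fun h => one_ne_zero (α := K) ?_⟩
  exact congrFun (of_injective (β := SSetCochain S K) 0 (h.trans (map_zero _).symm)) s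

theorem exists_toMayerVietoris_eq_algebraMap (hU : (subspaceInclusion U).hom.Nullhomotopic)
    (hV : (subspaceInclusion V).hom.Nullhomotopic) (hinter : (U ∩ V).Nonempty)
    (hz : z ∈ (cochainAlgebra _ K).deg 0) (hdz : (cochainAlgebra _ K).d z = 0) :
    ∃ c, (toMayerVietoris K U V).toAlgHom z = algebraMap K _ c := by
  obtain ⟨c, hc⟩ := exists_restriction_eq_algebraMap hU hz hdz
  obtain ⟨c', hc'⟩ := exists_restriction_eq_algebraMap hV hz hdz
  have : Nonempty (TopCat.toSSet.obj (TopCat.of (U ∩ V : Set X)) _⦋0⦌) :=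
    hinter.to_subtype.map (TopCat.toSSetObj₀Equiv (X := .of (U ∩ V : Set X))).symm
  let A := cochainAlgebra (TopCat.toSSet.obj (TopCat.of (U ∩ V : Set X))) K
  have : Nontrivial A.carrier := nontrivial_cochainAlgebra
  obtain rfl : c = c' := by
    refine (algebraMap K A.carrier).injective ?_
    rw [← AlgHom.commutes (restrictionOfSubset K U.inter_subset_left).toAlgHom, ← hc,
      ← AlgHom.commutes (restrictionOfSubset K U.inter_subset_right).toAlgHom, ← hc',
      restrictionOfSubset_restriction, restrictionOfSubset_restriction]
  exact ⟨c, by rw [toMayerVietoris_toAlgHom, hc, hc']; rfl⟩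

theorem isFormal_of_nonempty_inter (hU : IsOpen U) (hV : IsOpen V) (hUV : U ∪ V = .univ)
    (hU_null : (subspaceInclusion U).hom.Nullhomotopic)
    (hV_null : (subspaceInclusion V).hom.Nullhomotopic) (hinter : (U ∩ V).Nonempty) :
    (cochainAlgebra (TopCat.toSSet.obj X) K).IsFormal := by
  refine (toMayerVietoris_isQuasiIso hU hV hUV).isFormal_of_mul_eq_zero
    (HomotopyPullback.links _ _) (fun a ha b hb => HomotopyPullback.mul_eq_zero_of_mem_links ha hb)
    fun k z hz hdz => ?_
  obtain (_ | n) | n := k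
  · obtain ⟨c, hc⟩ := exists_toMayerVietoris_eq_algebraMap hU_null hV_null hinter hz hdz
    exact ⟨algebraMap K _ c, SetLike.algebraMap_mem_graded (mayerVietoris K U V).deg c,
      Submodule.mem_sup_left (Submodule.mem_one.2 ⟨c, rfl⟩), 0, by rw [hc, map_zero, sub_self]⟩
  · obtain ⟨l, hl, hl_link, hy⟩ :=
      exists_d_eq_toMayerVietoris_sub_link hU_null hV_null hz hdz
    exact ⟨l, hl, Submodule.mem_sup_right hl_link, hy⟩
  · obtain rfl : z = 0 := hz
    exact ⟨0, zero_mem _, zero_mem _, 0, by rw [map_zero, map_zero, sub_zero]⟩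

theorem isFormal_of_inter_eq_empty (hU : IsOpen U) (hV : IsOpen V) (hUV : U ∪ V = .univ)
    (hU_null : (subspaceInclusion U).hom.Nullhomotopic)
    (hV_null : (subspaceInclusion V).hom.Nullhomotopic) (hinter : U ∩ V = ∅) :
    (cochainAlgebra (TopCat.toSSet.obj X) K).IsFormal := by
  have : IsEmpty (U ∩ V : Set X) := Set.isEmpty_coe_sort.2 hinter
  refine isFormal_of_cohomology_concentrated_zero (fun k hk z hz hdz => ?_) fun a ha => ?_
  · obtain (_ | n) | n := k
    · exact absurd rfl hk
    · obtain ⟨l, -, hl_link, y, hy⟩ :=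
        exists_d_eq_toMayerVietoris_sub_link hU_null hV_null hz hdz
      have link_eq : HomotopyPullback.link l = 0 := DirectSum.ext fun n => funext fun s =>
        isEmptyElim ((TopCat.of (U ∩ V : Set X)).toSSetObjEquiv (op ⦋n⦌) s (stdSimplex.vertex 0))
      obtain rfl : l = 0 := TrivSqZeroExt.ext hl_link link_eq
      exact (toMayerVietoris_isQuasiIso hU hV hUV).1 _ hdz ⟨y, hy.trans (sub_zero _)⟩
    · obtain rfl : z = 0 := hz
      exact ⟨0, map_zero _⟩
  · obtain ⟨f, hf⟩ := ha
    have f_eq : f = 0 := by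
      rw [← of_eq_same (β := SSetCochain _ K) 0 f]
      exact (congrArg (· 0) hf).trans (totalCoboundary_apply_zero a)
    exact hf.symm.trans ((congrArg _ f_eq).trans (map_zero _))

theorem isFormal_of_union_eq_univ (hU : IsOpen U) (hV : IsOpen V) (hUV : U ∪ V = .univ)
    (hU_null : (subspaceInclusion U).hom.Nullhomotopic)
    (hV_null : (subspaceInclusion V).hom.Nullhomotopic) :
    (cochainAlgebra (TopCat.toSSet.obj X) K).IsFormal := by
  obtain hinter | hinter := (U ∩ V).eq_empty_or_nonempty
  · exact isFormal_of_inter_eq_empty hU hV hUV hU_null hV_null hinter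
  · exact isFormal_of_nonempty_inter hU hV hUV hU_null hV_null hinter

end MayerVietoris

theorem isFormal_of_isEmpty {S : SSet.{u}} {K : Type v} [Field K] [IsEmpty (S _⦋0⦌)] :
    (cochainAlgebra S K).IsFormal := by
  have one_eq : (1 : (cochainAlgebra S K).carrier) = 0 :=
    (congrArg (of (SSetCochain S K) 0) (Subsingleton.elim _ _)).trans (map_zero _)
  exact DGAlgebra.isFormal_of_one_mem_coboundaries ⟨0, (map_zero _).trans one_eq.symm⟩

end SSetCochain

theorem exists_hasCategoricalCover_of_lsCat_le {X : Type u} [TopologicalSpace X] {n : ℕ}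
    (h : lsCat X ≤ n) : ∃ m ≤ n + 1, HasCategoricalCover X m := by
  by_contra! hn
  have : ((n + 1 : ℕ) : ℕ∞) ≤ lsCat X := le_iInf₂ fun k ⟨m, hm, hc⟩ => by
    by_contra! hk
    exact hn m (by have := Nat.cast_lt.1 hk; omega) hc
  exact absurd (Nat.cast_le.1 (this.trans h)) (by omega)

theorem mainTheorem2_general {X : Type u} [TopologicalSpace X] {K : Type v} [Field K]
    (hX : lsCat X ≤ 1) : (singularCochainAlgebra X K).IsFormal := by
  obtain ⟨m, hm, U, hU, hU_univ, hU_null⟩ := exists_hasCategoricalCover_of_lsCat_le (n := 1) hX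
  obtain rfl | rfl | rfl : m = 0 ∨ m = 1 ∨ m = 2 := by omega
  · have : IsEmpty X := Set.univ_eq_empty_iff.1 (hU_univ.symm.trans (Set.iUnion_of_empty U))
    have : IsEmpty (TopCat.toSSet.obj (TopCat.of X) _⦋0⦌) := TopCat.toSSetObj₀Equiv.isEmpty
    exact SSetCochain.isFormal_of_isEmpty
  · have cover : U 0 ∪ U 0 = Set.univ := by simpa [Set.eq_univ_iff_forall] using hU_univ
    exact SSetCochain.isFormal_of_union_eq_univ (hU 0) (hU 0) cover (hU_null 0) (hU_null 0)
  · have cover : U 0 ∪ U 1 = Set.univ := by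
      simpa [Set.eq_univ_iff_forall, Fin.exists_fin_two] using hU_univ
    exact SSetCochain.isFormal_of_union_eq_univ (hU 0) (hU 1) cover (hU_null 0) (hU_null 1)

theorem mainTheorem2 {X : Type*} [TopologicalSpace X] {K : Type*} [Field K] [CharZero K]
    (hX : lsCat X ≤ 1) : (singularCochainAlgebra X K).IsFormal :=
  mainTheorem2_general hX
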